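/- Let $V$ be a finite subset of the unit sphere $S^3\subset\mathbb R^4$ that is contained in some open half-sphere and is contained in no hyperplane $\nu^\perp\cap S^3$ ($\nu\in S^3$). Let $C=\{\sum_{v\in V}a_v v : a_v\ge 0\}$ be the cone spanned by $V$ and $C^*=\{x\in\mathbb R^4:\langle x,y\rangle\le 0 \text{ for all } y\in C\}$ its dual cone. Let $Q=C\cap S^3$ be the convex polyhedron generated by $V$, $P=\partial Q$ the convex polyhedral sphere generated by $V$, $Q^*=C^*\cap S^3$ the dual polyhedron, and $P^*=\partial Q^*$ the dual polyhedral sphere, boundaries being taken in $S^3$. Then $$\operatorname{Area}(P)+\operatorname{Area}(P^*)=4\pi,$$ where the area of a convex polyhedral sphere is the sum of the areas of its faces, each face being a geodesic polygon in a unit great $2$-sphere of $S^3$. -/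

import Mathlib

noncomputable section

namespace SphericalPolyhedra

open MeasureTheory

/-- The unit sphere `S³` in `ℝ⁴`. -/
abbrev S3 : Type := Metric.sphere (0 : EuclideanSpace ℝ (Fin 4)) 1

/-- The hyperplane (great 2-sphere) `Π_ν` of `S³` with unit normal `ν`. -/
def hyperplane (ν : S3) : Set S3 :=
  {x | inner ℝ (ν : EuclideanSpace ℝ (Fin 4)) (x : EuclideanSpace ℝ (Fin 4)) = 0}

/-- The closed half-sphere `Δ_ν` of `S³` bounded by `Π_ν`, with outward unit normal `ν`. -/
def halfSphere (ν : S3) : Set S3 :=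
  {x | inner ℝ (ν : EuclideanSpace ℝ (Fin 4)) (x : EuclideanSpace ℝ (Fin 4)) ≤ 0}

/-- `X` is contained in some open half-sphere. -/
def IsHemispherical (X : Set S3) : Prop := ∃ x₀ : S3, X ⊆ (halfSphere x₀)ᶜ

/-- No hyperplane of `S³` contains `X`. -/
def IsNonPlanar (X : Set S3) : Prop := ¬ ∃ ν : S3, X ⊆ hyperplane ν

/-- The cone in `ℝ⁴` spanned by a finite subset of `S³`. -/
def cone (V : Finset S3) : Set (EuclideanSpace ℝ (Fin 4)) :=
  {x | ∃ a : S3 → ℝ, (∀ v ∈ V, 0 ≤ a v) ∧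
    x = ∑ v ∈ V, a v • (v : EuclideanSpace ℝ (Fin 4))}

/-- The polar cone `C* = {x : ⟨x, y⟩ ≤ 0 for all y ∈ C}`. -/
def dualCone (C : Set (EuclideanSpace ℝ (Fin 4))) : Set (EuclideanSpace ℝ (Fin 4)) :=
  {x | ∀ y ∈ C, inner ℝ x y ≤ 0}

/-- The trace on `S³` of a subset of `ℝ⁴`. -/
def trace (C : Set (EuclideanSpace ℝ (Fin 4))) : Set S3 := {x | (x : EuclideanSpace ℝ (Fin 4)) ∈ C}

/-- The convex polyhedron `Q` generated by `V`: the convex hull of `V` in `S³`. -/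
def polyhedron (V : Finset S3) : Set S3 := trace (cone V)

/-- The dual polyhedron `Q*`. -/
def dualPolyhedron (V : Finset S3) : Set S3 := trace (dualCone (cone V))

/-- The convex polyhedral sphere `P`: the boundary of `Q` relative to `S³`. -/
def polyhedralSphere (V : Finset S3) : Set S3 := frontier (polyhedron V)

/-- The dual polyhedral sphere `P*`: the boundary of `Q*` relative to `S³`. -/
def dualPolyhedralSphere (V : Finset S3) : Set S3 := frontier (dualPolyhedron V)

/-- The linear subspace of `ℝ⁴` spanned by a subset of `S³`. -/
abbrev linSpan (f : Set S3) : Submodule ℝ (EuclideanSpace ℝ (Fin 4)) :=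
  Submodule.span ℝ ((fun x : S3 => (x : EuclideanSpace ℝ (Fin 4))) '' f)

/-- The (two-dimensional) faces of a convex polyhedral sphere `P`: the intersections of `P` with
its support planes `Π_ν` which are two-dimensional, that is, contained in no great circle. -/
def faces (P : Set S3) : Set (Set S3) :=
  {f | ∃ ν : S3, P ⊆ halfSphere ν ∧ f = P ∩ hyperplane ν ∧ Module.finrank ℝ (linSpan f) = 3}

/-- The area of a face `f`, measured by the surface measure of the unit 2-sphere of the
three-dimensional linear subspace that `f` spans. -/
def faceArea (f : Set S3) : ENNReal :=
  (volume : Measure (linSpan f)).toSphere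
    {w | ∃ x ∈ f, (x : EuclideanSpace ℝ (Fin 4)) = ((w : linSpan f) : EuclideanSpace ℝ (Fin 4))}

/-- The area of a convex polyhedral sphere: the sum of the areas of its faces. -/
def area (P : Set S3) : ENNReal := ∑' f : faces P, faceArea (f : Set S3)

end SphericalPolyhedra

end

/-! The proof is integral geometry. Take a random orthonormal frame `X 0, …, X 3` of ℝ⁴ whose law is
invariant under isometries, and set L = span(`X 0`, `X 1`), so that L^⊥ = span(`X 2`, `X 3`).

Crofton's formula (`InvariantPair.exists_crofton`): L meets the hyperplane of a face almost surely
in a line, whose direction is uniform on the great 2-sphere of that face. The area of the face is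
therefore 4π times the probability that a chosen direction vector of this line lies in the cone.
Adding both signs and all faces, 2 · area is 4π times the expected number of boundary rays of the
cone lying in L. Almost surely L avoids all lower-dimensional faces, so this number is 2 if L meets
the interior of the cone and 0 otherwise.

Duality: L and L^⊥ cannot meet int C and int C* respectively, because a nonzero point of C* has
negative product with every point of int C. If L meets C only in 0, separating L from C gives a
nonzero vector of C* in L^⊥ (`SolidCone.exists_mem_dualCone_of_disjoint`). Hence almost surely
exactly one of the two planes cuts its cone, the two counts add up to 2, and 2 · (sum of areas) = 4π
· 2. -/

open MeasureTheory

set_option linter.unusedSectionVars false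

/-! ### Uniqueness of the invariant measure on a unit sphere -/

section UniformLaw

variable {W : Type*} [NormedAddCommGroup W] [InnerProductSpace ℝ W] [FiniteDimensional ℝ W]
  [MeasurableSpace W] [BorelSpace W]

/-- The reflection in the hyperplane orthogonal to s - t exchanges s and t when their norms agree,
so invariance makes the characteristic function radial. -/
theorem charFun_eq_of_norm_eq {μ : Measure W}
    (hμ : ∀ w : W, μ.map (ℝ ∙ w)ᗮ.reflection = μ) {s t : W} (h : ‖s‖ = ‖t‖) :
    charFun μ s = charFun μ t := by
  have hr := Submodule.reflection_sub h
  rw [← hr, charFun_apply, charFun_apply]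
  conv_lhs => rw [← hμ (s - t)]
  rw [integral_map (by fun_prop) (by fun_prop)]
  congr 1
  ext x
  rw [← LinearIsometryEquiv.inner_map_map ((ℝ ∙ (s - t))ᗮ.reflection) _ s]
  simp

/-- Reflection invariant measures on the unit sphere are proportional. -/
theorem eq_smul_of_reflection_invariant {μ ν : Measure W} [IsProbabilityMeasure μ]
    [IsFiniteMeasure ν]
    (hμ : ∀ w : W, μ.map (ℝ ∙ w)ᗮ.reflection = μ) (hν : ∀ w : W, ν.map (ℝ ∙ w)ᗮ.reflection = ν)
    (hμS : ∀ᵐ x ∂μ, ‖x‖ = 1) (hνS : ∀ᵐ x ∂ν, ‖x‖ = 1) :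
    ν = ν Set.univ • μ := by
  have : IsFiniteMeasure (ν Set.univ • μ) := Measure.smul_finite _ (measure_ne_top _ _)
  apply Measure.ext_of_charFun
  ext t
  -- The double integral of exp(i‖t‖⟨x, y⟩) against μ and ν is evaluated in both orders. Each inner
  -- integral is a radial characteristic function at a vector of norm ‖t‖, hence constant almost
  -- everywhere.
  have h1 : ∫ x, charFun μ (‖t‖ • x) ∂ν = ν.real Set.univ • charFun μ t := by
    rw [← integral_const]
    apply integral_congr_ae
    filter_upwards [hνS] with x hx
    exact charFun_eq_of_norm_eq hμ (by simp [norm_smul, hx])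
  have h2 : ∫ x, charFun ν (‖t‖ • x) ∂μ = charFun ν t := by
    have : ∫ x, charFun ν (‖t‖ • x) ∂μ = ∫ x, charFun ν t ∂μ := by
      apply integral_congr_ae
      filter_upwards [hμS] with x hx
      exact charFun_eq_of_norm_eq hν (by simp [norm_smul, hx])
    simpa using this
  have h3 : ∫ x, charFun μ (‖t‖ • x) ∂ν = ∫ x, charFun ν (‖t‖ • x) ∂μ := by
    simp_rw [charFun_apply]
    rw [integral_integral_swap]
    · congr 1
      ext x
      congr 1
      ext y
      simp only [inner_smul_right, real_inner_comm]
    · refine (integrable_const (1 : ℝ)).mono' ?_ ?_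
      · apply Continuous.aestronglyMeasurable
        simp only [Function.uncurry_def]
        fun_prop
      · refine .of_forall fun p => ?_
        simp only [Function.uncurry_def]
        rw [Complex.norm_exp_ofReal_mul_I]
  rw [← h2, ← h3, h1, charFun_apply, charFun_apply, integral_smul_measure]
  rfl

/-- Surface measure is, up to a factor, the volume of the truncated cone over a set; a linear
isometry preserves volume and commutes with forming this cone. -/
theorem map_reflection_toSphere [Nontrivial W] (w : W) :
    ((volume : Measure W).toSphere.map ((↑) : Metric.sphere (0 : W) 1 → W)).map
      (ℝ ∙ w)ᗮ.reflection = (volume : Measure W).toSphere.map (↑) := by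
  have hval : Measurable ((↑) : Metric.sphere (0 : W) 1 → W) := measurable_subtype_coe
  ext s hs
  set r := (ℝ ∙ w)ᗮ.reflection with hr
  have hrs : MeasurableSet (r ⁻¹' s) := r.continuous.measurable hs
  rw [Measure.map_apply r.continuous.measurable hs, Measure.map_apply hval hrs,
    Measure.map_apply hval hs, Measure.toSphere_apply' _ (hval hrs),
    Measure.toSphere_apply' _ (hval hs)]
  congr 1
  rw [← (r.measurePreserving).measure_preimage_equiv (f := r.toMeasurableEquiv)]
  congr 1
  ext x
  simp only [Set.mem_smul, Set.mem_image, Set.mem_preimage, Subtype.exists, exists_and_left,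
    exists_prop]
  constructor
  · rintro ⟨c, hc, _, ⟨y, hy, hyS, rfl⟩, h⟩
    refine ⟨c, hc, r y, ⟨r y, hy, by simpa using hyS, rfl⟩, ?_⟩
    rw [← map_smul, h]
    exact Submodule.reflection_reflection _ x
  · rintro ⟨c, hc, _, ⟨y, hy, hyS, rfl⟩, rfl⟩
    exact ⟨c, hc, r y, ⟨r y, by simpa [hr] using hy, by simpa using hyS, rfl⟩,
      (map_smul r c y).symm⟩

/-- An invariant probability measure on the unit sphere is the normalised surface measure. -/
theorem toSphere_eq_mul_of_reflection_invariant [Nontrivial W] {μ : Measure W}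
    [IsProbabilityMeasure μ]
    (hμ : ∀ w : W, μ.map (ℝ ∙ w)ᗮ.reflection = μ) (hμS : ∀ᵐ x ∂μ, ‖x‖ = 1)
    {s : Set W} (hs : MeasurableSet s) :
    (volume : Measure W).toSphere {w | (w : W) ∈ s}
      = (volume : Measure W).toSphere Set.univ * μ s := by
  have hval : Measurable ((↑) : Metric.sphere (0 : W) 1 → W) := measurable_subtype_coe
  have h := eq_smul_of_reflection_invariant (ν := (volume : Measure W).toSphere.map (↑)) hμ
    map_reflection_toSphere hμS (by
      rw [ae_map_iff hval.aemeasurable (measurableSet_eq_fun (by fun_prop) (by fun_prop))]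
      exact .of_forall fun x => by simp)
  have := congrArg (fun m => m s) h
  rwa [Measure.map_apply hval hs, Measure.map_apply hval MeasurableSet.univ] at this

/-- By proportionality it suffices to treat surface measure, where the cone over a subset of a
proper subspace stays in that subspace and has volume zero. -/
theorem measure_submodule_eq_zero_of_reflection_invariant [Nontrivial W] {μ : Measure W}
    [IsProbabilityMeasure μ]
    (hμ : ∀ w : W, μ.map (ℝ ∙ w)ᗮ.reflection = μ) (hμS : ∀ᵐ x ∂μ, ‖x‖ = 1)
    {U : Submodule ℝ W} (hU : U ≠ ⊤) : μ (U : Set W) = 0 := by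
  have hval : Measurable ((↑) : Metric.sphere (0 : W) 1 → W) := measurable_subtype_coe
  have hm : MeasurableSet (U : Set W) := U.closed_of_finiteDimensional.measurableSet
  have h := toSphere_eq_mul_of_reflection_invariant hμ hμS hm
  have h0 : (volume : Measure W).toSphere {w | (w : W) ∈ (U : Set W)} = 0 := by
    refine (Measure.toSphere_apply' _ (hval hm)).trans ?_
    have : (volume : Measure W) (U : Set W) = 0 := Measure.addHaar_submodule _ _ hU
    rw [measure_mono_null _ this, mul_zero]
    rintro _ ⟨c, -, _, ⟨y, hy, rfl⟩, rfl⟩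
    exact U.smul_mem c hy
  rw [h0] at h
  rcases mul_eq_zero.1 h.symm with h | h
  · exact absurd (Measure.measure_univ_eq_zero.1 h) (Measure.toSphere_ne_zero _)
  · exact h

end UniformLaw

/-! ### Random planes and their sections by a fixed hyperplane -/

section InvariantPair

variable {E : Type*} [NormedAddCommGroup E] [InnerProductSpace ℝ E]

theorem reflection_orthogonal_singleton_apply (w x : E) :
    (ℝ ∙ w)ᗮ.reflection x = x - (2 * (inner ℝ w x / ‖w‖ ^ 2)) • w := by
  rw [Submodule.reflection_orthogonal_apply, Submodule.reflection_singleton_apply]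
  simp [two_smul, two_mul, add_smul]

/-- The vector spanning the intersection of `span {a, b}` with the hyperplane `νᗮ`. -/
noncomputable def crossVector (ν a b : E) : E := (inner ℝ ν b : ℝ) • a - (inner ℝ ν a : ℝ) • b

theorem inner_crossVector (ν a b : E) : inner ℝ ν (crossVector ν a b) = (0 : ℝ) := by
  simp only [crossVector, inner_sub_right, inner_smul_right]
  ring

theorem crossVector_swap (ν a b : E) : crossVector ν b a = -crossVector ν a b := by
  simp [crossVector]

theorem crossVector_mem_span (ν a b : E) :
    crossVector ν a b ∈ Submodule.span ℝ ({a, b} : Set E) :=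
  sub_mem (Submodule.smul_mem _ _ (Submodule.subset_span (by simp)))
    (Submodule.smul_mem _ _ (Submodule.subset_span (by simp)))

theorem crossVector_ne_zero {ν a b : E} (hb : ‖b‖ = 1)
    (hab : inner ℝ a b = (0 : ℝ)) (h : inner ℝ ν a ≠ (0 : ℝ)) : crossVector ν a b ≠ 0 := by
  intro h0
  have := congrArg (fun x => (inner ℝ x b : ℝ)) h0
  simp [crossVector, inner_sub_left, inner_smul_left, hab, hb] at this
  exact h this

/-- Since a is not orthogonal to ν, the hyperplane cuts the plane in at most a line, and the
coefficient of a is determined by that of b. -/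
theorem exists_smul_crossVector {ν a b x : E} (h : inner ℝ ν a ≠ (0 : ℝ))
    (hx : x ∈ Submodule.span ℝ ({a, b} : Set E)) (hνx : inner ℝ ν x = (0 : ℝ)) :
    ∃ c : ℝ, x = c • crossVector ν a b := by
  obtain ⟨s, t, rfl⟩ := Submodule.mem_span_pair.1 hx
  rw [inner_add_right, inner_smul_right, inner_smul_right] at hνx
  refine ⟨-t / inner ℝ ν a, ?_⟩
  have hs : s = -t / inner ℝ ν a * inner ℝ ν b := by
    field_simp
    linarith
  rw [crossVector, smul_sub, smul_smul, smul_smul, ← hs, div_mul_cancel₀ _ h]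
  simp

variable [FiniteDimensional ℝ E] [MeasurableSpace E] [BorelSpace E]
  {Ω : Type*} [MeasurableSpace Ω]

/-- A random orthonormal pair whose law is invariant under reflections. -/
structure InvariantPair (P : Measure Ω) (a b : Ω → E) : Prop where
  measurable_left : Measurable a
  measurable_right : Measurable b
  norm_left : ∀ ω, ‖a ω‖ = 1
  norm_right : ∀ ω, ‖b ω‖ = 1
  inner_eq_zero : ∀ ω, inner ℝ (a ω) (b ω) = (0 : ℝ)
  equivariant : ∀ w : E, ∃ T : Ω → Ω, MeasurePreserving T P P ∧
    ∀ ω, a (T ω) = (ℝ ∙ w)ᗮ.reflection (a ω) ∧ b (T ω) = (ℝ ∙ w)ᗮ.reflection (b ω)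

namespace InvariantPair

variable {P : Measure Ω} {a b : Ω → E}

theorem symm (h : InvariantPair P a b) : InvariantPair P b a where
  measurable_left := h.measurable_right
  measurable_right := h.measurable_left
  norm_left := h.norm_right
  norm_right := h.norm_left
  inner_eq_zero ω := by rw [real_inner_comm, h.inner_eq_zero]
  equivariant w := by
    obtain ⟨T, hT, hab⟩ := h.equivariant w
    exact ⟨T, hT, fun ω => (hab ω).symm⟩

theorem ae_inner_ne_zero [IsProbabilityMeasure P] (h : InvariantPair P a b) {ν : E} (hν : ν ≠ 0) :
    ∀ᵐ ω ∂P, inner ℝ ν (a ω) ≠ (0 : ℝ) := by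
  have : Nontrivial E := ⟨ν, 0, hν⟩
  have : IsProbabilityMeasure (P.map a) :=
    Measure.isProbabilityMeasure_map h.measurable_left.aemeasurable
  have h0 := measure_submodule_eq_zero_of_reflection_invariant (μ := P.map a) (U := (ℝ ∙ ν)ᗮ)
    (fun w => by
      obtain ⟨T, hT, hab⟩ := h.equivariant w
      rw [Measure.map_map (by fun_prop) h.measurable_left]
      conv_rhs => rw [← hT.map_eq, Measure.map_map h.measurable_left hT.measurable]
      congr 1
      ext1 ω
      exact (hab ω).1.symm)
    (by
      rw [ae_map_iff h.measurable_left.aemeasurable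
        (measurableSet_eq_fun (by fun_prop) (by fun_prop))]
      exact .of_forall h.norm_left)
    (by
      intro htop
      have : ν ∈ (ℝ ∙ ν)ᗮ := htop ▸ Submodule.mem_top
      rw [Submodule.mem_orthogonal_singleton_iff_inner_right] at this
      exact hν (inner_self_eq_zero.1 this))
  rw [Measure.map_apply h.measurable_left
    (Submodule.closed_of_finiteDimensional _).measurableSet] at h0
  rw [ae_iff]
  convert h0 using 2
  ext ω
  simp [Submodule.mem_orthogonal_singleton_iff_inner_right]

theorem measurable_crossVector (h : InvariantPair P a b) (ν : E) :
    Measurable fun ω => crossVector ν (a ω) (b ω) := by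
  have := h.measurable_left
  have := h.measurable_right
  unfold crossVector
  fun_prop

theorem ae_crossVector_ne_zero [IsProbabilityMeasure P] (h : InvariantPair P a b) {ν : E} (hν : ν ≠ 0) :
    ∀ᵐ ω ∂P, crossVector ν (a ω) (b ω) ≠ 0 := by
  filter_upwards [h.ae_inner_ne_zero hν] with ω hω
  exact crossVector_ne_zero (h.norm_right ω) (h.inner_eq_zero ω) hω

/-- The normalised `crossVector`, as a random vector of the hyperplane `W`. -/
noncomputable def direction (W : Submodule ℝ E) (ν : E) (a b : Ω → E) (ω : Ω) : W :=
  ‖crossVector ν (a ω) (b ω)‖⁻¹ • W.orthogonalProjectionOnto (crossVector ν (a ω) (b ω))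

theorem coe_direction {W : Submodule ℝ E} {ν : E} (hW : ∀ x, x ∈ W ↔ inner ℝ ν x = (0 : ℝ))
    (a b : Ω → E) (ω : Ω) : (direction W ν a b ω : E)
      = ‖crossVector ν (a ω) (b ω)‖⁻¹ • crossVector ν (a ω) (b ω) := by
  have : crossVector ν (a ω) (b ω) ∈ W := (hW _).2 (inner_crossVector _ _ _)
  simp [direction, Submodule.starProjection_eq_self_iff.2 this]

theorem measurable_direction (h : InvariantPair P a b) (W : Submodule ℝ E) (ν : E) :
    Measurable (direction W ν a b) := by
  have := h.measurable_crossVector ν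
  unfold direction
  fun_prop

/-- Reflections along vectors of W fix ν, so they commute with forming `crossVector`; the invariance
of the pair thus descends to the direction inside W. -/
theorem direction_law [IsProbabilityMeasure P] (h : InvariantPair P a b) {W : Submodule ℝ E} {ν : E} (hν : ν ≠ 0)
    (hW : ∀ x, x ∈ W ↔ inner ℝ ν x = (0 : ℝ)) :
    (∀ w : W, (P.map (direction W ν a b)).map (ℝ ∙ w)ᗮ.reflection = P.map (direction W ν a b)) ∧
      ∀ᵐ x ∂P.map (direction W ν a b), ‖x‖ = 1 := by
  have hm := h.measurable_direction W ν
  constructor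
  · intro w
    obtain ⟨T, hT, hab⟩ := h.equivariant w
    rw [Measure.map_map (by fun_prop) hm]
    conv_rhs => rw [← hT.map_eq, Measure.map_map hm hT.measurable]
    congr 1
    ext1 ω
    have hνw : inner ℝ ν (w : E) = (0 : ℝ) := (hW _).1 w.2
    have hc : crossVector ν (a (T ω)) (b (T ω))
        = (ℝ ∙ (w : E))ᗮ.reflection (crossVector ν (a ω) (b ω)) := by
      simp only [crossVector, (hab ω).1, (hab ω).2, map_sub, map_smul]
      congr 2 <;>
      · rw [reflection_orthogonal_singleton_apply, inner_sub_right, inner_smul_right, hνw]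
        simp
    apply Subtype.ext
    simp only [Function.comp_apply]
    rw [coe_direction hW, hc, LinearIsometryEquiv.norm_map, ← map_smul,
      reflection_orthogonal_singleton_apply, reflection_orthogonal_singleton_apply,
      ← coe_direction hW]
    simp
  · rw [ae_map_iff hm.aemeasurable (measurableSet_eq_fun (by fun_prop) (by fun_prop))]
    filter_upwards [h.ae_crossVector_ne_zero hν] with ω hω
    rw [← Submodule.norm_coe, coe_direction hW, norm_smul, norm_inv, norm_norm,
      inv_mul_cancel₀ (norm_ne_zero_iff.2 hω)]

/-- Crofton's formula for a single hyperplane section of a cone. -/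
theorem toSphere_eq_mul_crossVector [IsProbabilityMeasure P] (h : InvariantPair P a b) {W : Submodule ℝ E} [Nontrivial W]
    {ν : E} (hν : ν ≠ 0) (hW : ∀ x, x ∈ W ↔ inner ℝ ν x = (0 : ℝ)) {K : Set E}
    (hK : MeasurableSet K) (hcone : ∀ c : ℝ, 0 < c → ∀ x ∈ K, c • x ∈ K) :
    (volume : Measure W).toSphere {w | ((w : W) : E) ∈ K}
      = (volume : Measure W).toSphere Set.univ * P {ω | crossVector ν (a ω) (b ω) ∈ K} := by
  have hm := h.measurable_direction W ν
  have : IsProbabilityMeasure (P.map (direction W ν a b)) :=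
    Measure.isProbabilityMeasure_map hm.aemeasurable
  obtain ⟨h1, h2⟩ := h.direction_law hν hW
  have hKW : MeasurableSet ((↑) ⁻¹' K : Set W) := measurable_subtype_coe hK
  have := toSphere_eq_mul_of_reflection_invariant h1 h2 hKW
  refine this.trans ?_
  rw [Measure.map_apply hm hKW]
  congr 1
  apply measure_congr
  filter_upwards [h.ae_crossVector_ne_zero hν] with ω hω
  apply propext
  change (direction W ν a b ω : E) ∈ K ↔ crossVector ν (a ω) (b ω) ∈ K
  rw [coe_direction hW]
  have hpos := norm_pos_iff.2 hω
  constructor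
  · intro hx
    simpa [smul_smul, hpos.ne'] using hcone _ hpos _ hx
  · exact hcone _ (inv_pos.2 hpos) _

/-- The random plane almost surely avoids a proper subspace of a hyperplane. -/
theorem ae_disjoint [IsProbabilityMeasure P] (h : InvariantPair P a b) {U W : Submodule ℝ E} {ν : E} (hν : ν ≠ 0)
    (hW : ∀ x, x ∈ W ↔ inner ℝ ν x = (0 : ℝ)) (hUW : U < W) :
    ∀ᵐ ω ∂P, ∀ x ∈ Submodule.span ℝ ({a ω, b ω} : Set E), x ∈ U → x = 0 := by
  obtain ⟨z, hzW, hzU⟩ := SetLike.exists_of_lt hUW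
  have : Nontrivial W := ⟨⟨z, hzW⟩, 0, fun h0 => hzU (by
    rw [Subtype.ext_iff] at h0
    simp only [ZeroMemClass.coe_zero] at h0
    rw [h0]; exact U.zero_mem)⟩
  have hm := h.measurable_direction W ν
  have : IsProbabilityMeasure (P.map (direction W ν a b)) :=
    Measure.isProbabilityMeasure_map hm.aemeasurable
  obtain ⟨h1, h2⟩ := h.direction_law hν hW
  have h0 := measure_submodule_eq_zero_of_reflection_invariant h1 h2 (U := U.comap W.subtype) (by
    intro htop
    have : (⟨z, hzW⟩ : W) ∈ U.comap W.subtype := htop ▸ Submodule.mem_top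
    exact hzU this)
  rw [Measure.map_apply hm (Submodule.closed_of_finiteDimensional _).measurableSet] at h0
  have h3 : ∀ᵐ ω ∂P, (direction W ν a b ω : E) ∉ U := by
    rw [ae_iff]
    convert h0 using 2
    ext ω
    simp
  filter_upwards [h3, h.ae_inner_ne_zero hν, h.ae_crossVector_ne_zero hν] with ω h4 h5 h6 x hx hxU
  -- A common nonzero vector of the plane and U would be a multiple of the direction in W, which is
  -- uniform there and so almost surely outside the proper subspace U.
  obtain ⟨c, rfl⟩ := exists_smul_crossVector h5 hx ((hW _).1 (hUW.le hxU))
  by_contra hne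
  have hc : c ≠ 0 := by
    rintro rfl
    simp at hne
  apply h4
  rw [coe_direction hW]
  apply U.smul_mem
  simpa [smul_smul, hc] using U.smul_mem c⁻¹ hxU

end InvariantPair

end InvariantPair

/-! ### A random frame from Haar measure on the orthogonal group -/

section RandomFrame

universe u

variable (E : Type u) [NormedAddCommGroup E] [InnerProductSpace ℝ E] [FiniteDimensional ℝ E]

instance compactSpace_unitary : CompactSpace (unitary (E →L[ℝ] E)) := by
  refine (isCompact_iff_compactSpace (X := E →L[ℝ] E) (s := (unitary (E →L[ℝ] E) : Set (E →L[ℝ] E)))).1 ?_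
  apply Metric.isCompact_of_isClosed_isBounded
  · have : (unitary (E →L[ℝ] E) : Set (E →L[ℝ] E))
        = {u | star u * u = 1} ∩ {u | u * star u = 1} := by
      ext u; simp [Unitary.mem_iff]
    rw [this]
    exact (isClosed_eq (by fun_prop) (by fun_prop)).inter
      (isClosed_eq (by fun_prop) (by fun_prop))
  · refine (Metric.isBounded_closedBall (x := (0 : E →L[ℝ] E)) (r := 1)).subset fun u hu => ?_
    rw [mem_closedBall_zero_iff]
    refine ContinuousLinearMap.opNorm_le_bound _ zero_le_one fun x => ?_
    rw [one_mul]
    exact ((Unitary.linearIsometryEquiv (𝕜 := ℝ) ⟨u, hu⟩).norm_map x).le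

/-- There is a random orthonormal frame with law invariant under isometries. -/
theorem exists_random_frame [MeasurableSpace E] [BorelSpace E] {ι : Type*}
    {e : ι → E} (he : Orthonormal ℝ e) :
    ∃ (Ω : Type u) (_ : MeasurableSpace Ω) (P : Measure Ω) (X : ι → Ω → E),
      IsProbabilityMeasure P ∧ (∀ ω, Orthonormal ℝ fun i => X i ω) ∧
      ∀ i j, i ≠ j → InvariantPair P (X i) (X j) := by
  let G := unitary (E →L[ℝ] E)
  let : MeasurableSpace G := borel G
  have : BorelSpace G := ⟨rfl⟩
  let P : Measure G := Measure.haarMeasure ⊤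
  let X : ι → G → E := fun i g => (g : E →L[ℝ] E) (e i)
  have hX : ∀ i, Measurable (X i) := fun i =>
    Continuous.measurable (by fun_prop)
  have hortho : ∀ ω : G, Orthonormal ℝ fun i => X i ω := fun ω =>
    he.comp_linearIsometryEquiv (Unitary.linearIsometryEquiv (𝕜 := ℝ) ω)
  refine ⟨↥G, inferInstance, P, X, ⟨?_⟩, hortho, fun i j hij => ?_⟩
  · simpa using Measure.haarMeasure_self (K₀ := (⊤ : TopologicalSpace.PositiveCompacts G))
  · refine ⟨hX i, hX j, fun ω => (hortho ω).1 i, fun ω => (hortho ω).1 j,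
      fun ω => (hortho ω).2 hij, fun w => ?_⟩
    -- Reflecting the frame is left multiplication by R, which preserves Haar measure.
    let R : G := Unitary.linearIsometryEquiv.symm (ℝ ∙ w)ᗮ.reflection
    exact ⟨fun g => R * g, measurePreserving_mul_left P R, fun ω => ⟨rfl, rfl⟩⟩

end RandomFrame

open scoped Pointwise

/-! ### Convex geometry of pointed closed cones with interior -/

section SolidCone

variable {E : Type*} [NormedAddCommGroup E] [InnerProductSpace ℝ E]

/-- A closed convex cone with nonempty interior that is positive for some linear functional. -/
structure SolidCone (K : Set E) : Prop where
  isClosed : IsClosed K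
  add_mem : ∀ x ∈ K, ∀ y ∈ K, x + y ∈ K
  smul_mem : ∀ c : ℝ, 0 ≤ c → ∀ x ∈ K, c • x ∈ K
  interior_nonempty : (interior K).Nonempty
  exists_pos : ∃ x₀ : E, ∀ y ∈ K, y ≠ 0 → (0 : ℝ) < inner ℝ x₀ y

/-- `ν` is an outward normal vector of a support hyperplane of the cone `K`. -/
def IsNormal (K : Set E) (ν : E) : Prop := ν ≠ 0 ∧ ∀ y ∈ K, inner ℝ ν y ≤ (0 : ℝ)

/-- The face of the cone `K` exposed by `ν`. -/
def exposedFace (K : Set E) (ν : E) : Set E := {y | y ∈ K ∧ inner ℝ ν y = (0 : ℝ)}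

namespace SolidCone

variable {K : Set E}

theorem zero_mem (h : SolidCone K) : (0 : E) ∈ K := by
  obtain ⟨z, hz⟩ := h.interior_nonempty
  simpa using h.smul_mem 0 le_rfl z (interior_subset hz)

theorem convex (h : SolidCone K) : Convex ℝ K := fun _ hx _ hy _ _ ha hb _ =>
  h.add_mem _ (h.smul_mem _ ha _ hx) _ (h.smul_mem _ hb _ hy)

theorem eq_zero_of_neg_mem (h : SolidCone K) {x : E} (hx : x ∈ K) (hx' : -x ∈ K) : x = 0 := by
  obtain ⟨x₀, h₀⟩ := h.exists_pos
  by_contra hne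
  have h1 := h₀ x hx hne
  have h2 := h₀ (-x) hx' (neg_ne_zero.2 hne)
  rw [inner_neg_right] at h2
  linarith

theorem mem_of_smul_mem (h : SolidCone K) {c : ℝ} (hc : 0 < c) {x : E} (hx : c • x ∈ K) :
    x ∈ K := by
  simpa [smul_smul, hc.ne'] using h.smul_mem c⁻¹ (inv_nonneg.2 hc.le) _ hx

theorem exists_add_smul_mem_interior {z : E} (hz : z ∈ interior K) (w : E) :
    ∃ ε : ℝ, 0 < ε ∧ z + ε • w ∈ interior K := by
  have hc : Continuous fun t : ℝ => z + t • w := by fun_prop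
  have ho : IsOpen ((fun t : ℝ => z + t • w) ⁻¹' interior K) := isOpen_interior.preimage hc
  obtain ⟨ε, hε, hb⟩ := Metric.isOpen_iff.1 ho 0 (by simpa using hz)
  refine ⟨ε / 2, half_pos hε, hb ?_⟩
  rw [Metric.mem_ball, Real.dist_eq, sub_zero, abs_of_pos (half_pos hε)]
  linarith

/-- A small step from x in the direction ν stays in K yet strictly increases the product with ν,
which must remain nonpositive. -/
theorem inner_neg_of_mem_interior {ν : E} (hν : IsNormal K ν) {x : E} (hx : x ∈ interior K) :
    inner ℝ ν x < (0 : ℝ) := by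
  obtain ⟨ε, hε, h⟩ := exists_add_smul_mem_interior hx ν
  have h1 := hν.2 _ (interior_subset h)
  rw [inner_add_right, inner_smul_right, real_inner_self_eq_norm_sq] at h1
  have h2 : 0 < ε * ‖ν‖ ^ 2 := by
    have := norm_pos_iff.2 hν.1
    positivity
  linarith

theorem zero_notMem_interior [Nontrivial E] (h : SolidCone K) : (0 : E) ∉ interior K := by
  intro h0
  obtain ⟨w, hw⟩ := exists_ne (0 : E)
  have hmem : ∀ y, y ∈ K := fun y => by
    obtain ⟨ε, hε, hy⟩ := exists_add_smul_mem_interior h0 y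
    rw [zero_add] at hy
    exact h.mem_of_smul_mem hε (interior_subset hy)
  exact hw (h.eq_zero_of_neg_mem (hmem _) (hmem _))

theorem smul_mem_interior (h : SolidCone K) {c : ℝ} (hc : 0 < c) {x : E} (hx : x ∈ interior K) :
    c • x ∈ interior K := by
  have h1 : c • interior K ⊆ interior K := by
    apply interior_maximal _ (isOpen_interior.smul₀ hc.ne')
    rintro _ ⟨y, hy, rfl⟩
    exact h.smul_mem c hc.le _ (interior_subset hy)
  exact h1 ⟨x, hx, rfl⟩

variable [CompleteSpace E]

/-- A convex set disjoint from the interior of a cone is separated from it by a normal. -/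
theorem exists_normal_of_disjoint (h : SolidCone K) {t : Set E} (ht : Convex ℝ t)
    (hne : t.Nonempty) (hd : Disjoint (interior K) t) :
    ∃ ν, IsNormal K ν ∧ ∀ x ∈ t, (0 : ℝ) ≤ inner ℝ ν x := by
  obtain ⟨f, u, hf, hK, htu⟩ :=
    geometric_hahn_banach_of_nonempty_interior h.convex ht hd h.interior_nonempty hne
  have hu : 0 ≤ u := by simpa using hK 0 h.zero_mem
  refine ⟨(InnerProductSpace.toDual ℝ E).symm f, ⟨by simpa using hf, fun y hy => ?_⟩,
    fun x hx => ?_⟩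
  · rw [InnerProductSpace.toDual_symm_apply]
    by_contra! hpos
    -- A functional bounded above on a cone is nonpositive there: this multiple of y would have
    -- value u + 1.
    have := hK _ (h.smul_mem ((u + 1) / f y) (by positivity) y hy)
    rw [map_smul, smul_eq_mul, div_mul_cancel₀ _ hpos.ne'] at this
    linarith
  · rw [InnerProductSpace.toDual_symm_apply]
    exact hu.trans (htu x hx)

theorem exists_normal_of_notMem_interior (h : SolidCone K) {x : E} (hx : x ∈ K)
    (hxi : x ∉ interior K) : ∃ ν, IsNormal K ν ∧ inner ℝ ν x = (0 : ℝ) := by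
  obtain ⟨ν, hν, hν'⟩ := h.exists_normal_of_disjoint (convex_singleton x)
    (Set.singleton_nonempty x) (Set.disjoint_singleton_right.2 hxi)
  exact ⟨ν, hν, le_antisymm (hν.2 x hx) (hν' x rfl)⟩

/-- At a point with a unique normal, the cone contains all directions of the open half space. -/
theorem exists_add_smul_mem_interior_of_unique (h : SolidCone K) {x ν d : E} (hx : x ∈ K)
    (huniq : ∀ ν', IsNormal K ν' → inner ℝ ν' x = (0 : ℝ) → ∃ c : ℝ, 0 < c ∧ ν' = c • ν)
    (hd : inner ℝ ν d < (0 : ℝ)) : ∃ ε : ℝ, 0 < ε ∧ x + ε • d ∈ interior K := by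
  by_contra! hno
  -- If the open ray from x along d missed the interior, a separating normal would vanish at x,
  -- hence be a positive multiple of ν, and be nonnegative on d.
  obtain ⟨ν', hν', hν't⟩ := h.exists_normal_of_disjoint
    (t := (fun ε : ℝ => x + ε • d) '' Set.Ioi 0)
    (by
      rintro _ ⟨s, hs, rfl⟩ _ ⟨t, ht, rfl⟩ α β hα hβ hαβ
      refine ⟨α * s + β * t, ?_, ?_⟩
      · exact convex_Ioi (0 : ℝ) hs ht hα hβ hαβ
      · have : x = α • x + β • x := by rw [← add_smul, hαβ, one_smul]
        simp only
        nth_rw 1 [this]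
        module)
    ⟨_, 1, Set.mem_Ioi.2 one_pos, rfl⟩
    (Set.disjoint_left.2 (by
      rintro _ hy ⟨ε, hε, rfl⟩
      exact hno ε hε hy))
  have h1 : ∀ ε : ℝ, 0 < ε → 0 ≤ inner ℝ ν' x + ε * inner ℝ ν' d := fun ε hε => by
    simpa [inner_add_right, inner_smul_right] using hν't _ ⟨ε, hε, rfl⟩
  have h2 := hν'.2 x hx
  have h3 : inner ℝ ν' x = (0 : ℝ) := by
    refine le_antisymm h2 (le_of_forall_pos_le_add fun δ hδ => ?_)
    -- This step length is small enough to change the product with ν' by at most δ; it replaces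
    -- letting ε tend to 0 in `h1`.
    have h4 := h1 (δ / (|inner ℝ ν' d| + 1)) (by positivity)
    have h5 : δ / (|inner ℝ ν' d| + 1) * inner ℝ ν' d ≤ δ := by
      rw [div_mul_eq_mul_div, div_le_iff₀ (by positivity)]
      nlinarith [le_abs_self (inner ℝ ν' d : ℝ)]
    linarith
  obtain ⟨c, hc, rfl⟩ := huniq ν' hν' h3
  have h4 := h1 1 one_pos
  rw [h3, inner_smul_left] at h4
  simp at h4
  nlinarith

/-- The functional x₀ is positive on K away from 0 but vanishes at w, so w is not in K. As (z + t •
w)/t tends to w and K is closed, the ray leaves K after a finite time, which is taken as T. -/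
theorem exists_exit (h : SolidCone K) {z w x₀ : E} (hz : z ∈ interior K)
    (h₀ : ∀ y ∈ K, y ≠ 0 → (0 : ℝ) < inner ℝ x₀ y) (hw : w ≠ 0) (hw₀ : inner ℝ x₀ w = (0 : ℝ)) :
    ∃ T : ℝ, 0 < T ∧ (∀ t : ℝ, 0 ≤ t → (z + t • w ∈ K ↔ t ≤ T)) ∧
      z + T • w ∉ interior K := by
  let S : Set ℝ := {t | 0 ≤ t ∧ z + t • w ∈ K}
  have hS : IsClosed S :=
    isClosed_Ici.inter (h.isClosed.preimage (f := fun t : ℝ => z + t • w) (by fun_prop))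
  have hwK : w ∉ K := fun hmem => (h₀ w hmem hw).ne' hw₀
  have hbdd : BddAbove S := by
    have hc : Continuous fun s : ℝ => w + s • z := by fun_prop
    have ho : IsOpen ((fun s : ℝ => w + s • z) ⁻¹' Kᶜ) := h.isClosed.isOpen_compl.preimage hc
    obtain ⟨ε, hε, hb⟩ := Metric.isOpen_iff.1 ho 0 (by simpa using hwK)
    refine ⟨ε⁻¹, fun t ht => ?_⟩
    by_contra! hlt
    have htpos : 0 < t := (inv_pos.2 hε).trans hlt
    refine hb (a := t⁻¹) ?_ ?_
    · rw [Metric.mem_ball, Real.dist_eq, sub_zero, abs_of_pos (inv_pos.2 htpos)]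
      exact inv_lt_of_inv_lt₀ hε hlt
    · have := h.smul_mem t⁻¹ (inv_nonneg.2 htpos.le) _ ht.2
      simpa [smul_smul, htpos.ne', add_comm] using this
  have hmem : sSup S ∈ S := hS.csSup_mem ⟨0, le_rfl, by simpa using interior_subset hz⟩ hbdd
  obtain ⟨ε, hε, hεi⟩ := exists_add_smul_mem_interior hz w
  have hpos : 0 < sSup S := hε.trans_le (le_csSup hbdd ⟨hε.le, interior_subset hεi⟩)
  refine ⟨sSup S, hpos, fun t ht => ⟨fun hK => le_csSup hbdd ⟨ht, hK⟩, fun hle => ?_⟩,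
    fun hint => ?_⟩
  · have h1 : 0 ≤ t / sSup S := by positivity
    have h2 : t / sSup S ≤ 1 := (div_le_one hpos).2 hle
    have h3 := h.convex (interior_subset hz) hmem.2 (sub_nonneg.2 h2) h1 (by ring)
    have h4 : t / sSup S * sSup S = t := by field_simp
    have h5 : (1 - t / sSup S) • z + (t / sSup S) • (z + sSup S • w)
        = z + (t / sSup S * sSup S) • w := by module
    rwa [h5, h4] at h3
  · obtain ⟨δ, hδ, hδi⟩ := exists_add_smul_mem_interior hint w
    have : sSup S + δ ≤ sSup S :=
      le_csSup hbdd ⟨by positivity, by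
        have := interior_subset hδi
        rwa [add_assoc, ← add_smul] at this⟩
    linarith

/-- A plane section of a solid cone: a sector bounded by two boundary rays. -/
theorem exists_segment (h : SolidCone K) {z w x₀ : E} (hz : z ∈ interior K)
    (h₀ : ∀ y ∈ K, y ≠ 0 → (0 : ℝ) < inner ℝ x₀ y) (hw : w ≠ 0) (hw₀ : inner ℝ x₀ w = (0 : ℝ)) :
    ∃ s t : ℝ, 0 < s ∧ 0 < t ∧ z - s • w ∈ K ∧ z + t • w ∈ K ∧
      z - s • w ∉ interior K ∧ z + t • w ∉ interior K ∧
      ∀ r : ℝ, z + r • w ∈ K → z + r • w ∉ interior K → r = -s ∨ r = t := by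
  obtain ⟨t, ht, htK, hti⟩ := h.exists_exit hz h₀ hw hw₀
  obtain ⟨s, hs, hsK, hsi⟩ := h.exists_exit hz h₀ (neg_ne_zero.2 hw)
    (by rw [inner_neg_right, hw₀, neg_zero])
  have hopen : ∀ (u : E) (T r : ℝ), 0 < T → z + T • u ∈ K → 0 ≤ r → r < T →
      z + r • u ∈ interior K := by
    intro u T r hT hTK hr hrT
    rcases hr.eq_or_lt with rfl | hr
    · simpa using hz
    apply h.convex.openSegment_interior_self_subset_interior hz hTK
    refine ⟨1 - r / T, r / T, sub_pos.2 ((div_lt_one hT).2 hrT), by positivity, by ring, ?_⟩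
    have h4 : r / T * T = r := by field_simp
    have h5 : (1 - r / T) • z + (r / T) • (z + T • u) = z + (r / T * T) • u := by module
    rw [h5, h4]
  refine ⟨s, t, hs, ht, ?_, (htK t ht.le).2 le_rfl, ?_, hti, fun r hr hri => ?_⟩
  · simpa [sub_eq_add_neg] using (hsK s hs.le).2 le_rfl
  · simpa [sub_eq_add_neg] using hsi
  · rcases le_total 0 r with h0 | h0
    · right
      refine le_antisymm ((htK r h0).1 hr) ?_
      by_contra! hlt
      exact hri (hopen w t r ht ((htK t ht.le).2 le_rfl) h0 hlt)
    · left
      have hneg : z + r • w = z + (-r) • (-w) := by simp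
      rw [hneg] at hr hri
      have h1 := (hsK (-r) (by linarith)).1 hr
      have h2 : s ≤ -r := by
        by_contra! hlt
        exact hri (hopen (-w) s (-r) hs ((hsK s hs.le).2 le_rfl) (by linarith) hlt)
      linarith

theorem exists_mem_span_orthogonal {a b x₀ z : E} (ha : ‖a‖ = 1) (hb : ‖b‖ = 1)
    (hab : inner ℝ a b = (0 : ℝ)) (hz : z ∈ Submodule.span ℝ ({a, b} : Set E))
    (h₀ : inner ℝ x₀ z ≠ (0 : ℝ)) :
    ∃ w ∈ Submodule.span ℝ ({a, b} : Set E), w ≠ 0 ∧ inner ℝ x₀ w = (0 : ℝ) ∧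
      ∀ u ∈ Submodule.span ℝ ({a, b} : Set E), inner ℝ x₀ u = (0 : ℝ) → ∃ c : ℝ, u = c • w := by
  by_cases h : inner ℝ x₀ a = (0 : ℝ)
  · have h' : inner ℝ x₀ b ≠ (0 : ℝ) := by
      intro h'
      obtain ⟨s, t, rfl⟩ := Submodule.mem_span_pair.1 hz
      simp [inner_add_right, inner_smul_right, h, h'] at h₀
    refine ⟨crossVector x₀ b a, ?_, ?_, inner_crossVector _ _ _, fun u hu hu0 => ?_⟩
    · rw [Set.pair_comm]
      exact crossVector_mem_span _ _ _
    · exact crossVector_ne_zero ha (by rwa [real_inner_comm]) h'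
    · exact exists_smul_crossVector h' (by rwa [Set.pair_comm]) hu0
  · exact ⟨crossVector x₀ a b, crossVector_mem_span _ _ _, crossVector_ne_zero hb hab h,
      inner_crossVector _ _ _, fun u hu hu0 => exists_smul_crossVector h hu hu0⟩

/-- A plane meeting the interior of a solid cone meets its boundary in exactly two rays. -/
theorem exists_boundary_rays (h : SolidCone K) {a b z : E} (ha : ‖a‖ = 1) (hb : ‖b‖ = 1)
    (hab : inner ℝ a b = (0 : ℝ)) (hz : z ∈ Submodule.span ℝ ({a, b} : Set E))
    (hzi : z ∈ interior K) (hz0 : z ≠ 0) :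
    ∃ p ∈ Submodule.span ℝ ({a, b} : Set E), ∃ q ∈ Submodule.span ℝ ({a, b} : Set E),
      p ∈ K ∧ q ∈ K ∧ p ∉ interior K ∧ q ∉ interior K ∧ p ≠ 0 ∧ q ≠ 0 ∧
      (∀ x ∈ Submodule.span ℝ ({a, b} : Set E), x ∈ K → x ∉ interior K → x ≠ 0 →
        ∃ c : ℝ, x = c • p ∨ x = c • q) ∧
      ∀ ν, IsNormal K ν → inner ℝ ν p = (0 : ℝ) → inner ℝ ν q ≠ (0 : ℝ) := by
  obtain ⟨x₀, h₀⟩ := h.exists_pos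
  have hz₀ := h₀ z (interior_subset hzi) hz0
  obtain ⟨w, hwL, hw, hw₀, hspan⟩ := exists_mem_span_orthogonal ha hb hab hz hz₀.ne'
  obtain ⟨s, t, hs, ht, hsK, htK, hsi, hti, hr⟩ := h.exists_segment hzi h₀ hw hw₀
  have hne : ∀ r : ℝ, z + r • w ≠ 0 := by
    intro r h0
    have := congrArg (inner ℝ x₀ · : E → ℝ) h0
    simp only [inner_add_right, inner_smul_right, hw₀, inner_zero_right] at this
    linarith
  refine ⟨z - s • w, sub_mem hz (Submodule.smul_mem _ _ hwL), z + t • w,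
    Submodule.add_mem _ hz (Submodule.smul_mem _ _ hwL), hsK, htK, hsi, hti, ?_, hne t, ?_, ?_⟩
  · simpa [sub_eq_add_neg] using hne (-s)
  · intro x hxL hxK hxi hx0
    have hx₀ := h₀ x hxK hx0
    -- Rescaling to the level of z under x₀ puts x on the affine line z + ℝw, where only the two
    -- endpoints are boundary points.
    set c := inner ℝ x₀ x / inner ℝ x₀ z with hc
    have hcpos : 0 < c := div_pos hx₀ hz₀
    obtain ⟨e, he⟩ := hspan (x - c • z) (sub_mem hxL (Submodule.smul_mem _ _ hz)) (by
      rw [inner_sub_right, inner_smul_right, hc, div_mul_cancel₀ _ hz₀.ne', sub_self])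
    have hx : x = c • (z + (e / c) • w) := by
      rw [smul_add, smul_smul, mul_div_cancel₀ _ hcpos.ne', ← he]
      abel
    refine ⟨c, ?_⟩
    rcases hr (e / c) (h.mem_of_smul_mem hcpos (hx ▸ hxK)) (fun hi => hxi (by
      rw [hx]; exact h.smul_mem_interior hcpos hi)) with h1 | h1
    · left
      rw [hx, h1, neg_smul, sub_eq_add_neg]
    · right
      rw [hx, h1]
  -- The point z lies strictly between p and q, so a normal vanishing at both would vanish at an
  -- interior point.
  · intro ν hν h1 h2
    have h3 := inner_neg_of_mem_interior hν hzi
    rw [inner_sub_right, inner_smul_right] at h1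
    rw [inner_add_right, inner_smul_right] at h2
    nlinarith

theorem exists_smul_eq_of_orthogonal_le {ν ν' : E} (h : (ℝ ∙ ν)ᗮ ≤ (ℝ ∙ ν')ᗮ) :
    ∃ c : ℝ, ν' = c • ν := by
  have h1 := Submodule.orthogonal_le h
  rw [Submodule.orthogonal_orthogonal, Submodule.orthogonal_orthogonal] at h1
  obtain ⟨c, hc⟩ := Submodule.mem_span_singleton.1 (h1 (Submodule.mem_span_singleton_self ν'))
  exact ⟨c, hc.symm⟩

theorem exists_pos_smul_eq_of_orthogonal_le (h : SolidCone K) {ν ν' : E} (hν : IsNormal K ν)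
    (hν' : IsNormal K ν') (hle : (ℝ ∙ ν)ᗮ ≤ (ℝ ∙ ν')ᗮ) : ∃ c : ℝ, 0 < c ∧ ν' = c • ν := by
  obtain ⟨c, rfl⟩ := exists_smul_eq_of_orthogonal_le hle
  obtain ⟨z, hz⟩ := h.interior_nonempty
  refine ⟨c, ?_, rfl⟩
  have h1 := inner_neg_of_mem_interior hν hz
  have h2 := inner_neg_of_mem_interior hν' hz
  rw [inner_smul_left] at h2
  simp at h2
  nlinarith

theorem span_exposedFace_le (ν : E) : Submodule.span ℝ (exposedFace K ν) ≤ (ℝ ∙ ν)ᗮ := by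
  rw [Submodule.span_le]
  intro y hy
  exact Submodule.mem_orthogonal_singleton_iff_inner_right.2 hy.2

end SolidCone

end SolidCone

/-! ### General position of a random plane with respect to a polyhedral cone -/

section Transversality

variable {E : Type*} [NormedAddCommGroup E] [InnerProductSpace ℝ E] [FiniteDimensional ℝ E]
  [MeasurableSpace E] [BorelSpace E] {Ω : Type*} [MeasurableSpace Ω] {P : Measure Ω}
  [IsProbabilityMeasure P] {a b : Ω → E} {K : Set E}

/-- The family of exposed faces of a cone. -/
def exposedFaces (K : Set E) : Set (Set E) := {F | ∃ ν, IsNormal K ν ∧ F = exposedFace K ν}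

/-- A random plane meets the boundary of a polyhedral cone only inside its facets. -/
theorem InvariantPair.ae_transverse (h : InvariantPair P a b) (hK : SolidCone K)
    (hfin : (exposedFaces K).Finite) :
    ∀ᵐ ω ∂P, ∀ x ∈ Submodule.span ℝ ({a ω, b ω} : Set E), x ∈ K → x ≠ 0 →
      ∀ ν, IsNormal K ν → inner ℝ ν x = (0 : ℝ) →
        inner ℝ ν (a ω) ≠ (0 : ℝ) ∧ Submodule.span ℝ (exposedFace K ν) = (ℝ ∙ ν)ᗮ ∧
        ∀ ν', IsNormal K ν' → inner ℝ ν' x = (0 : ℝ) → ∃ c : ℝ, 0 < c ∧ ν' = c • ν := by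
  -- One normal is fixed per exposed face. There may be infinitely many normals but only finitely
  -- many faces, so only finitely many null sets are discarded.
  choose! n hn hnF using fun F (hF : F ∈ exposedFaces K) => hF
  have hW : ∀ ν x : E, x ∈ (ℝ ∙ ν)ᗮ ↔ inner ℝ ν x = (0 : ℝ) := fun ν x =>
    Submodule.mem_orthogonal_singleton_iff_inner_right
  have h1 : ∀ᵐ ω ∂P, ∀ F ∈ exposedFaces K, inner ℝ (n F) (a ω) ≠ (0 : ℝ) :=
    (ae_ball_iff hfin.countable).2 fun F hF => h.ae_inner_ne_zero (hn F hF).1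
  have h2 : ∀ᵐ ω ∂P, ∀ F ∈ exposedFaces K, Submodule.span ℝ F < (ℝ ∙ n F)ᗮ →
      ∀ x ∈ Submodule.span ℝ ({a ω, b ω} : Set E), x ∈ Submodule.span ℝ F → x = 0 := by
    refine (ae_ball_iff hfin.countable).2 fun F hF => ?_
    by_cases hlt : Submodule.span ℝ F < (ℝ ∙ n F)ᗮ
    · filter_upwards [h.ae_disjoint (hn F hF).1 (hW _) hlt] with ω hω _ using hω
    · exact .of_forall fun ω h' => absurd h' hlt
  -- Two different supporting hyperplanes meet in a proper subspace of each, which the plane avoids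
  -- outside 0; this yields uniqueness of the normal at x.
  have h3 : ∀ᵐ ω ∂P, ∀ F ∈ exposedFaces K, ∀ G ∈ exposedFaces K,
      (ℝ ∙ n F)ᗮ ⊓ (ℝ ∙ n G)ᗮ < (ℝ ∙ n F)ᗮ →
      ∀ x ∈ Submodule.span ℝ ({a ω, b ω} : Set E), x ∈ (ℝ ∙ n F)ᗮ ⊓ (ℝ ∙ n G)ᗮ → x = 0 := by
    refine (ae_ball_iff hfin.countable).2 fun F hF => ?_
    refine (ae_ball_iff hfin.countable).2 fun G hG => ?_
    by_cases hlt : (ℝ ∙ n F)ᗮ ⊓ (ℝ ∙ n G)ᗮ < (ℝ ∙ n F)ᗮ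
    · filter_upwards [h.ae_disjoint (hn F hF).1 (hW _) hlt] with ω hω _ using hω
    · exact .of_forall fun ω h' => absurd h' hlt
  filter_upwards [h1, h2, h3] with ω g1 g2 g3 x hxL hxK hx0
  have key : ∀ ν, IsNormal K ν → inner ℝ ν x = (0 : ℝ) → ∃ F ∈ exposedFaces K,
      F = exposedFace K ν ∧ Submodule.span ℝ F = (ℝ ∙ n F)ᗮ ∧ inner ℝ (n F) x = (0 : ℝ) ∧
      ∃ c : ℝ, 0 < c ∧ ν = c • n F := by
    intro ν hν hνx
    have hF : exposedFace K ν ∈ exposedFaces K := ⟨ν, hν, rfl⟩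
    have hxF : x ∈ exposedFace K ν := ⟨hxK, hνx⟩
    have hle : Submodule.span ℝ (exposedFace K ν) ≤ (ℝ ∙ n (exposedFace K ν))ᗮ := by
      conv_lhs => rw [hnF _ hF]
      exact SolidCone.span_exposedFace_le _
    have heq : Submodule.span ℝ (exposedFace K ν) = (ℝ ∙ n (exposedFace K ν))ᗮ := by
      by_contra hne
      exact hx0 (g2 _ hF (lt_of_le_of_ne hle hne) x hxL (Submodule.subset_span hxF))
    refine ⟨_, hF, rfl, heq, ?_, ?_⟩
    · rw [hnF _ hF] at hxF
      exact hxF.2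
    · exact hK.exists_pos_smul_eq_of_orthogonal_le (hn _ hF) hν
        (heq ▸ SolidCone.span_exposedFace_le _)
  intro ν hν hνx
  obtain ⟨F, hF, hFν, hFs, hFx, c, hc, hcν⟩ := key ν hν hνx
  refine ⟨?_, ?_, fun ν' hν' hνx' => ?_⟩
  · rw [hcν, inner_smul_left]
    exact mul_ne_zero (by simpa using hc.ne') (g1 F hF)
  · rw [← hFν, hFs, hcν, Submodule.span_singleton_smul_eq (IsUnit.mk0 c hc.ne')]
  · obtain ⟨G, hG, -, -, hGx, d, hd, hdν⟩ := key ν' hν' hνx'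
    have hle : (ℝ ∙ n F)ᗮ ≤ (ℝ ∙ n G)ᗮ := by
      by_contra hnle
      exact hx0 (g3 F hF G hG (inf_lt_left.2 hnle) x hxL ⟨(hW _ _).2 hFx, (hW _ _).2 hGx⟩)
    obtain ⟨e, he, heq⟩ := hK.exists_pos_smul_eq_of_orthogonal_le (hn F hF) (hn G hG) hle
    refine ⟨d * e / c, by positivity, ?_⟩
    rw [hdν, heq, hcν, smul_smul, smul_smul, div_mul_cancel₀ _ hc.ne']

/-- A random plane meeting a polyhedral cone nontrivially meets its interior. -/
theorem InvariantPair.ae_meets_interior_or (h : InvariantPair P a b) (hK : SolidCone K)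
    (hfin : (exposedFaces K).Finite) :
    ∀ᵐ ω ∂P, (∃ z ∈ Submodule.span ℝ ({a ω, b ω} : Set E), z ∈ interior K) ∨
      ∀ x ∈ Submodule.span ℝ ({a ω, b ω} : Set E), x ∈ K → x = 0 := by
  filter_upwards [h.ae_transverse hK hfin] with ω hω
  by_contra! hno
  obtain ⟨hno, x, hxL, hxK, hx0⟩ := hno
  obtain ⟨ν, hν, hνx⟩ := hK.exists_normal_of_notMem_interior hxK (hno x hxL)
  obtain ⟨hνa, -, huniq⟩ := hω x hxL hxK hx0 ν hν hνx
  have haL : a ω ∈ Submodule.span ℝ ({a ω, b ω} : Set E) := Submodule.subset_span (by simp)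
  -- As ν is not orthogonal to a, one of ±a points into the open half space; uniqueness of the
  -- normal at x then makes x + ε • d interior.
  obtain ⟨d, hdL, hd⟩ : ∃ d ∈ Submodule.span ℝ ({a ω, b ω} : Set E), inner ℝ ν d < (0 : ℝ) := by
    rcases hνa.lt_or_gt with hlt | hgt
    · exact ⟨a ω, haL, hlt⟩
    · exact ⟨-a ω, neg_mem haL, by rw [inner_neg_right]; linarith⟩
  obtain ⟨ε, -, hε⟩ := hK.exists_add_smul_mem_interior_of_unique hxK huniq hd
  exact hno _ (add_mem hxL (Submodule.smul_mem _ _ hdL)) hε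

end Transversality

/-! ### Faces on S³ and Crofton's formula -/

section SphericalTrace

open SphericalPolyhedra Topology

variable {K : Set (EuclideanSpace ℝ (Fin 4))}

theorem S3.ne_zero (x : S3) : (x : EuclideanSpace ℝ (Fin 4)) ≠ 0 := by
  have : ‖(x : EuclideanSpace ℝ (Fin 4))‖ = 1 := by simp
  exact norm_ne_zero_iff.1 (by rw [this]; exact one_ne_zero)

/-- The radial projection of a nonzero vector to the unit sphere. -/
noncomputable def toS3 (x : EuclideanSpace ℝ (Fin 4)) (hx : x ≠ 0) : S3 :=
  ⟨‖x‖⁻¹ • x, by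
    rw [mem_sphere_zero_iff_norm, norm_smul, norm_inv, norm_norm,
      inv_mul_cancel₀ (norm_ne_zero_iff.2 hx)]⟩

theorem smul_toS3 (x : EuclideanSpace ℝ (Fin 4)) (hx : x ≠ 0) :
    ‖x‖ • (toS3 x hx : EuclideanSpace ℝ (Fin 4)) = x := by
  simp [toS3, smul_smul, hx]

/-- Radial projection is continuous away from 0 and K is stable under scaling, so a neighbourhood in
the sphere thickens to one in ℝ⁴. -/
theorem SolidCone.interior_trace (hK : SolidCone K) :
    interior (trace K) = trace (interior K) := by
  apply Set.Subset.antisymm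
  · intro x hx
    obtain ⟨O, hO, hOU⟩ := isOpen_induced_iff.1 (isOpen_interior (s := trace K))
    change (x : EuclideanSpace ℝ (Fin 4)) ∈ interior K
    rw [mem_interior_iff_mem_nhds]
    have hx1 : ‖(x : EuclideanSpace ℝ (Fin 4))‖ = 1 := by simp
    have hc : ContinuousAt (fun y : EuclideanSpace ℝ (Fin 4) => ‖y‖⁻¹ • y) x :=
      (continuous_norm.continuousAt.inv₀ (by rw [hx1]; exact one_ne_zero)).smul continuousAt_id
    have hxO : ‖(x : EuclideanSpace ℝ (Fin 4))‖⁻¹ • (x : EuclideanSpace ℝ (Fin 4)) ∈ O := by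
      rw [hx1, inv_one, one_smul]
      have : x ∈ Subtype.val ⁻¹' O := hOU ▸ hx
      exact this
    filter_upwards [hc.preimage_mem_nhds (hO.mem_nhds hxO),
      isOpen_ne.mem_nhds (S3.ne_zero x)] with y hy hy0
    have hmem : toS3 y hy0 ∈ trace K := by
      apply interior_subset
      rw [← hOU]
      exact hy
    rw [← smul_toS3 y hy0]
    exact hK.smul_mem _ (norm_nonneg y) _ hmem
  · exact interior_maximal (fun x hx => interior_subset (s := K) hx)
      (isOpen_interior.preimage continuous_subtype_val)

theorem SolidCone.mem_frontier_trace (hK : SolidCone K) (x : S3) :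
    x ∈ frontier (trace K) ↔ (x : EuclideanSpace ℝ (Fin 4)) ∈ K ∧
      (x : EuclideanSpace ℝ (Fin 4)) ∉ interior K := by
  have hcl : IsClosed (trace K) := hK.isClosed.preimage continuous_subtype_val
  rw [hcl.frontier_eq, hK.interior_trace]
  rfl

/-- Every interior point of K lies strictly inside a segment with endpoints on the boundary, so a
linear inequality valid on the boundary holds on all of K. -/
theorem SolidCone.frontier_trace_subset_halfSphere_iff (hK : SolidCone K) (ν : S3) :
    frontier (trace K) ⊆ halfSphere ν ↔ IsNormal K (ν : EuclideanSpace ℝ (Fin 4)) := by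
  constructor
  · intro h
    have hbd : ∀ y ∈ K, y ∉ interior K →
        inner ℝ (ν : EuclideanSpace ℝ (Fin 4)) y ≤ (0 : ℝ) := by
      intro y hy hyi
      by_cases hy0 : y = 0
      · simp [hy0]
      have hpos := norm_pos_iff.2 hy0
      have hmem : toS3 y hy0 ∈ frontier (trace K) := by
        rw [hK.mem_frontier_trace]
        constructor
        · exact hK.smul_mem _ (inv_nonneg.2 hpos.le) _ hy
        · intro hi
          have := hK.smul_mem_interior hpos hi
          rw [smul_toS3] at this
          exact hyi this
      have h1 : inner ℝ (ν : EuclideanSpace ℝ (Fin 4)) (toS3 y hy0 : EuclideanSpace ℝ (Fin 4))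
        ≤ (0 : ℝ) := h hmem
      rw [← smul_toS3 y hy0, inner_smul_right]
      exact mul_nonpos_of_nonneg_of_nonpos hpos.le h1
    refine ⟨S3.ne_zero ν, fun y hy => ?_⟩
    by_cases hyi : y ∈ interior K
    · obtain ⟨x₀, h₀⟩ := hK.exists_pos
      have hx₀ : ∃ w ≠ 0, inner ℝ x₀ w = (0 : ℝ) := by
        have : (ℝ ∙ x₀)ᗮ ≠ ⊥ := by
          intro h0
          rw [Submodule.orthogonal_eq_bot_iff] at h0
          have h1 := finrank_span_le_card (R := ℝ) ({x₀} : Set (EuclideanSpace ℝ (Fin 4)))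
          rw [h0, finrank_top] at h1
          simp at h1
        obtain ⟨w, hw, hw0⟩ := Submodule.exists_mem_ne_zero_of_ne_bot this
        exact ⟨w, hw0, Submodule.mem_orthogonal_singleton_iff_inner_right.1 hw⟩
      obtain ⟨w, hw, hw₀⟩ := hx₀
      obtain ⟨s, t, hs, ht, hsK, htK, hsi, hti, -⟩ := hK.exists_segment hyi h₀ hw hw₀
      have h1 := hbd _ hsK hsi
      have h2 := hbd _ htK hti
      rw [inner_sub_right, inner_smul_right] at h1
      rw [inner_add_right, inner_smul_right] at h2
      by_contra! hlt
      nlinarith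
    · exact hbd y hy hyi
  · intro h x hx
    exact h.2 _ ((hK.mem_frontier_trace x).1 hx).1

theorem SolidCone.frontier_trace_inter_hyperplane (hK : SolidCone K) {ν : S3}
    (hν : IsNormal K (ν : EuclideanSpace ℝ (Fin 4))) :
    frontier (trace K) ∩ hyperplane ν = trace (exposedFace K ν) := by
  ext x
  rw [Set.mem_inter_iff, hK.mem_frontier_trace]
  constructor
  · exact fun h => ⟨h.1.1, h.2⟩
  · exact fun h => ⟨⟨h.1, fun hi => (SolidCone.inner_neg_of_mem_interior hν hi).ne h.2⟩, h.2⟩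

theorem SolidCone.mem_faces_iff (hK : SolidCone K) (f : Set S3) :
    f ∈ faces (frontier (trace K)) ↔ ∃ ν : S3, IsNormal K (ν : EuclideanSpace ℝ (Fin 4)) ∧
      f = trace (exposedFace K ν) ∧ Module.finrank ℝ (linSpan f) = 3 := by
  constructor
  · rintro ⟨ν, h1, h2, h3⟩
    rw [hK.frontier_trace_subset_halfSphere_iff] at h1
    exact ⟨ν, h1, h2.trans (hK.frontier_trace_inter_hyperplane h1), h3⟩
  · rintro ⟨ν, h1, h2, h3⟩
    exact ⟨ν, (hK.frontier_trace_subset_halfSphere_iff ν).2 h1,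
      h2.trans (hK.frontier_trace_inter_hyperplane h1).symm, h3⟩

theorem SolidCone.toS3_mem_exposedFace (hK : SolidCone K) {x ν : EuclideanSpace ℝ (Fin 4)}
    (hx : x ∈ exposedFace K ν) (hx0 : x ≠ 0) : toS3 x hx0 ∈ trace (exposedFace K ν) := by
  refine ⟨hK.smul_mem _ (inv_nonneg.2 (norm_nonneg x)) _ hx.1, ?_⟩
  simp only [toS3]
  rw [inner_smul_right, hx.2, mul_zero]

theorem SolidCone.linSpan_trace_exposedFace (hK : SolidCone K)
    (ν : EuclideanSpace ℝ (Fin 4)) :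
    linSpan (trace (exposedFace K ν)) = Submodule.span ℝ (exposedFace K ν) := by
  apply le_antisymm
  · apply Submodule.span_mono
    rintro _ ⟨x, hx, rfl⟩
    exact hx
  · rw [Submodule.span_le]
    intro y hy
    by_cases hy0 : y = 0
    · rw [hy0]
      exact Submodule.zero_mem _
    · rw [← smul_toS3 y hy0]
      exact Submodule.smul_mem _ _
        (Submodule.subset_span ⟨_, hK.toS3_mem_exposedFace hy hy0, rfl⟩)

theorem finrank_orthogonal_S3 {ν : EuclideanSpace ℝ (Fin 4)} (hν : ν ≠ 0) :
    Module.finrank ℝ (ℝ ∙ ν)ᗮ = 3 := by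
  have : Fact (Module.finrank ℝ (EuclideanSpace ℝ (Fin 4)) = 3 + 1) := ⟨by simp⟩
  exact Submodule.finrank_orthogonal_span_singleton hν

theorem SolidCone.finite_faces (hK : SolidCone K) (hfin : (exposedFaces K).Finite) :
    (faces (frontier (trace K))).Finite := by
  refine (hfin.image trace).subset fun f hf => ?_
  obtain ⟨ν, hν, rfl, -⟩ := (hK.mem_faces_iff f).1 hf
  exact ⟨_, ⟨ν, hν, rfl⟩, rfl⟩

theorem toSphere_univ_of_finrank_three {W : Type*} [NormedAddCommGroup W] [InnerProductSpace ℝ W]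
    [FiniteDimensional ℝ W] [MeasurableSpace W] [BorelSpace W] (h : Module.finrank ℝ W = 3) :
    (volume : Measure W).toSphere Set.univ = ENNReal.ofReal (4 * Real.pi) := by
  have : Nontrivial W := Module.nontrivial_of_finrank_pos (R := ℝ) (by omega)
  rw [Measure.toSphere_apply_univ, InnerProductSpace.volume_ball_of_dim_odd (k := 1) (by omega), h]
  rw [ENNReal.ofReal_one, one_pow, one_mul, ← ENNReal.ofReal_natCast,
    ← ENNReal.ofReal_mul (by positivity)]
  congr 1
  norm_num [Nat.doubleFactorial]
  ring

variable {Ω : Type*} [MeasurableSpace Ω] {P : Measure Ω}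
  [IsProbabilityMeasure P] {a b : Ω → EuclideanSpace ℝ (Fin 4)}

/-- A two-dimensional face spans the whole hyperplane orthogonal to ν, and is the part of its unit
sphere lying in K; the single-hyperplane Crofton formula applies. -/
theorem InvariantPair.faceArea_eq (h : InvariantPair P a b) (hK : SolidCone K) {ν : S3}
    (h3 : Module.finrank ℝ (linSpan (trace (exposedFace K ν))) = 3) :
    faceArea (trace (exposedFace K ν)) = ENNReal.ofReal (4 * Real.pi) *
      P {ω | crossVector (ν : EuclideanSpace ℝ (Fin 4)) (a ω) (b ω) ∈ K} := by
  set f := trace (exposedFace K ν) with hf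
  have hle : linSpan f ≤ (ℝ ∙ (ν : EuclideanSpace ℝ (Fin 4)))ᗮ := by
    rw [hf, hK.linSpan_trace_exposedFace]
    exact SolidCone.span_exposedFace_le _
  have heq := Submodule.eq_of_le_of_finrank_eq hle
    (h3.trans (finrank_orthogonal_S3 (S3.ne_zero ν)).symm)
  have hW : ∀ x, x ∈ linSpan f ↔ inner ℝ (ν : EuclideanSpace ℝ (Fin 4)) x = (0 : ℝ) := fun x => by
    rw [heq, Submodule.mem_orthogonal_singleton_iff_inner_right]
  have : Nontrivial (linSpan f) := Module.nontrivial_of_finrank_pos (R := ℝ) (by omega)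
  rw [← toSphere_univ_of_finrank_three h3, ← h.toSphere_eq_mul_crossVector (S3.ne_zero ν) hW
    hK.isClosed.measurableSet fun c hc => hK.smul_mem c hc.le, faceArea]
  congr 1
  ext w
  constructor
  · rintro ⟨x, hx, hxw⟩
    exact (hxw ▸ hx.1 : ((w : linSpan f) : EuclideanSpace ℝ (Fin 4)) ∈ K)
  · intro hw
    have hw1 : ‖((w : linSpan f) : EuclideanSpace ℝ (Fin 4))‖ = 1 := by
      rw [Submodule.norm_coe]; simp
    exact ⟨⟨_, mem_sphere_zero_iff_norm.2 hw1⟩, ⟨hw, (hW _).1 (w : linSpan f).2⟩, rfl⟩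

/-- Crofton's formula for polyhedral spheres. -/
theorem InvariantPair.exists_crofton (h : InvariantPair P a b) (hK : SolidCone K)
    (hfin : (exposedFaces K).Finite) :
    ∃ N : Ω → ENNReal, Measurable N ∧
      2 * area (frontier (trace K)) = ENNReal.ofReal (4 * Real.pi) * ∫⁻ ω, N ω ∂P ∧
      ∀ᵐ ω ∂P, ((∃ z ∈ Submodule.span ℝ ({a ω, b ω} : Set (EuclideanSpace ℝ (Fin 4))),
          z ∈ interior K) ∧ N ω = 2) ∨
        ((∀ x ∈ Submodule.span ℝ ({a ω, b ω} : Set (EuclideanSpace ℝ (Fin 4))),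
          x ∈ K → x = 0) ∧ N ω = 0) := by
  have : Countable (faces (frontier (trace K))) := (hK.finite_faces hfin).countable.to_subtype
  choose n hn hnf hn3 using fun f : faces (frontier (trace K)) => (hK.mem_faces_iff f).1 f.2
  let X : faces (frontier (trace K)) → Ω → EuclideanSpace ℝ (Fin 4) := fun f ω =>
    crossVector (n f : EuclideanSpace ℝ (Fin 4)) (a ω) (b ω)
  have hX : ∀ f, MeasurableSet {ω | X f ω ∈ K} := fun f =>
    h.measurable_crossVector _ hK.isClosed.measurableSet
  have hX' : ∀ f, MeasurableSet {ω | -X f ω ∈ K} := fun f =>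
    (h.measurable_crossVector _).neg hK.isClosed.measurableSet
  -- Both directions of the line are counted, which accounts for the factor 2 in front of the area.
  -- Exchanging a and b turns X into -X, so both terms have the same expectation.
  let g : faces (frontier (trace K)) → Ω → ENNReal := fun f ω =>
    Set.indicator {ω | X f ω ∈ K} 1 ω + Set.indicator {ω | -X f ω ∈ K} 1 ω
  have hg : ∀ f, Measurable (g f) := fun f =>
    (measurable_one.indicator (hX f)).add (measurable_one.indicator (hX' f))
  have hgi : ∀ f : faces (frontier (trace K)),
      2 * faceArea (f : Set S3) = ENNReal.ofReal (4 * Real.pi) * ∫⁻ ω, g f ω ∂P := by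
    intro f
    have h3 := hn3 f
    rw [hnf f] at h3
    rw [lintegral_add_left (measurable_one.indicator (hX f)), lintegral_indicator_one (hX f),
      lintegral_indicator_one (hX' f), mul_add, two_mul]
    congr 1
    · conv_lhs => rw [hnf f]
      exact h.faceArea_eq hK h3
    · conv_lhs => rw [hnf f]
      rw [h.symm.faceArea_eq hK h3]
      simp only [X, ← crossVector_swap]
  refine ⟨fun ω => ∑' f, g f ω, Measurable.tsum hg, ?_, ?_⟩
  · rw [lintegral_tsum fun f => (hg f).aemeasurable, ← ENNReal.tsum_mul_left, area,
      ← ENNReal.tsum_mul_left]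
    exact tsum_congr hgi
  · have hne : ∀ᵐ ω ∂P, ∀ f, inner ℝ (n f : EuclideanSpace ℝ (Fin 4)) (a ω) ≠ (0 : ℝ) :=
      ae_all_iff.2 fun f => h.ae_inner_ne_zero (S3.ne_zero _)
    filter_upwards [h.ae_transverse hK hfin, h.ae_meets_interior_or hK hfin, hne]
      with ω htr hor hω
    have hXL : ∀ f, X f ω ∈ Submodule.span ℝ ({a ω, b ω} : Set (EuclideanSpace ℝ (Fin 4))) :=
      fun f => crossVector_mem_span _ _ _
    have hX0 : ∀ f, X f ω ≠ 0 := fun f =>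
      crossVector_ne_zero (h.norm_right ω) (h.inner_eq_zero ω) (hω f)
    have hXn : ∀ f, inner ℝ (n f : EuclideanSpace ℝ (Fin 4)) (X f ω) = (0 : ℝ) := fun f =>
      inner_crossVector _ _ _
    by_cases hz : ∃ z ∈ Submodule.span ℝ ({a ω, b ω} : Set (EuclideanSpace ℝ (Fin 4))),
        z ∈ interior K
    swap
    · right
      have h0 := hor.resolve_left hz
      refine ⟨h0, ENNReal.tsum_eq_zero.2 fun f => ?_⟩
      have h1 : ω ∉ {ω | X f ω ∈ K} := fun hm => hX0 f (h0 _ (hXL f) hm)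
      have h2 : ω ∉ {ω | -X f ω ∈ K} := fun hm =>
        hX0 f (neg_eq_zero.1 (h0 _ (neg_mem (hXL f)) hm))
      simp only [g, Set.indicator_of_notMem h1, Set.indicator_of_notMem h2, add_zero]
    left
    refine ⟨hz, ?_⟩
    obtain ⟨z, hzL, hzi⟩ := hz
    -- By transversality, each boundary ray of the section lies in exactly one face.
    have facet : ∀ p ∈ Submodule.span ℝ ({a ω, b ω} : Set (EuclideanSpace ℝ (Fin 4))),
        p ∈ K → p ∉ interior K → p ≠ 0 → ∃ f₁ : faces (frontier (trace K)),
          ∀ f, inner ℝ (n f : EuclideanSpace ℝ (Fin 4)) p = (0 : ℝ) ↔ f = f₁ := by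
      intro p hpL hpK hpi hp0
      obtain ⟨ν, hν, hνp⟩ := hK.exists_normal_of_notMem_interior hpK hpi
      set μ := toS3 ν hν.1 with hμ
      have hμe : (μ : EuclideanSpace ℝ (Fin 4)) = ‖ν‖⁻¹ • ν := rfl
      have hμn : IsNormal K (μ : EuclideanSpace ℝ (Fin 4)) := by
        refine ⟨S3.ne_zero μ, fun y hy => ?_⟩
        rw [hμe, inner_smul_left]
        exact mul_nonpos_of_nonneg_of_nonpos (by simp) (hν.2 y hy)
      have hμp : inner ℝ (μ : EuclideanSpace ℝ (Fin 4)) p = (0 : ℝ) := by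
        rw [hμe, inner_smul_left, hνp, mul_zero]
      obtain ⟨-, hspan, huniq⟩ := htr p hpL hpK hp0 _ hμn hμp
      have hmem : trace (exposedFace K μ) ∈ faces (frontier (trace K)) := by
        rw [hK.mem_faces_iff]
        refine ⟨μ, hμn, rfl, ?_⟩
        rw [hK.linSpan_trace_exposedFace, hspan]
        exact finrank_orthogonal_S3 (S3.ne_zero μ)
      refine ⟨⟨_, hmem⟩, fun f => ⟨fun hf => ?_, ?_⟩⟩
      · obtain ⟨c, hc, hcn⟩ := huniq _ (hn f) hf
        -- Face normals are unit vectors, so positive proportionality is equality.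
        have hc1 : c = 1 := by
          have := congrArg norm hcn
          rw [norm_smul, Real.norm_eq_abs, abs_of_pos hc] at this
          simpa using this.symm
        apply Subtype.ext
        rw [hnf f, hcn, hc1, one_smul]
      · intro hf
        have h1 : toS3 p hp0 ∈ (f : Set S3) := by
          rw [hf]
          exact hK.toS3_mem_exposedFace ⟨hpK, hμp⟩ hp0
        rw [hnf f] at h1
        have h2 : inner ℝ (n f : EuclideanSpace ℝ (Fin 4))
          (toS3 p hp0 : EuclideanSpace ℝ (Fin 4)) = (0 : ℝ) := h1.2
        rw [← smul_toS3 p hp0, inner_smul_right, h2, mul_zero]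
    have hz0 : z ≠ 0 := fun h0 => hK.zero_notMem_interior (h0 ▸ hzi)
    obtain ⟨p, hpL, q, hqL, hpK, hqK, hpi, hqi, hp0, hq0, hrays, hpq⟩ :=
      hK.exists_boundary_rays (h.norm_left ω) (h.norm_right ω) (h.inner_eq_zero ω) hzL hzi hz0
    obtain ⟨f₁, hf₁⟩ := facet p hpL hpK hpi hp0
    obtain ⟨f₂, hf₂⟩ := facet q hqL hqK hqi hq0
    -- When the line of f carries a nonzero point of K, exactly one of ±X lies in K, because K
    -- contains no line.
    have hone : ∀ f x, x ∈ Submodule.span ℝ ({a ω, b ω} : Set (EuclideanSpace ℝ (Fin 4))) →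
        x ∈ K → x ≠ 0 → inner ℝ (n f : EuclideanSpace ℝ (Fin 4)) x = (0 : ℝ) → g f ω = 1 := by
      intro f x hxL hxK hx0 hx
      obtain ⟨c, hc⟩ := exists_smul_crossVector (hω f) hxL hx
      have hXx : x = c • X f ω := hc
      have hc0 : c ≠ 0 := by
        rintro rfl
        simp [hc] at hx0
      rcases hc0.lt_or_gt with hlt | hgt
      · have h1 : -X f ω ∈ K := hK.mem_of_smul_mem (neg_pos.2 hlt) (by
          rwa [neg_smul_neg, ← hXx])
        have h2 : X f ω ∉ K := fun hm => hX0 f (hK.eq_zero_of_neg_mem hm h1)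
        have h1' : ω ∈ {ω | -X f ω ∈ K} := h1
        have h2' : ω ∉ {ω | X f ω ∈ K} := h2
        simp only [g, Set.indicator_of_mem h1', Set.indicator_of_notMem h2', zero_add,
          Pi.one_apply]
      · have h1 : X f ω ∈ K := hK.mem_of_smul_mem hgt (by rwa [← hXx])
        have h2 : -X f ω ∉ K := fun hm => hX0 f (hK.eq_zero_of_neg_mem h1 hm)
        have h1' : ω ∈ {ω | X f ω ∈ K} := h1
        have h2' : ω ∉ {ω | -X f ω ∈ K} := h2
        simp only [g, Set.indicator_of_mem h1', Set.indicator_of_notMem h2', add_zero,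
          Pi.one_apply]
    have hne12 : f₁ ≠ f₂ := fun he =>
      hpq _ (hn f₁) ((hf₁ f₁).2 rfl) ((hf₂ f₁).2 he)
    have hray : ∀ f x, x ∈ Submodule.span ℝ ({a ω, b ω} : Set (EuclideanSpace ℝ (Fin 4))) →
        x ∈ K → x ≠ 0 → inner ℝ (n f : EuclideanSpace ℝ (Fin 4)) x = (0 : ℝ) →
        f = f₁ ∨ f = f₂ := by
      intro f x hxL hxK hx0 hx
      obtain ⟨c, hc⟩ := hrays x hxL hxK
        (fun hi => (SolidCone.inner_neg_of_mem_interior (hn f) hi).ne hx) hx0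
      have hc0 : c ≠ 0 := by
        rintro rfl
        simp [hx0] at hc
      rcases hc with rfl | rfl
      · rw [inner_smul_right] at hx
        exact Or.inl ((hf₁ f).1 ((mul_eq_zero.1 hx).resolve_left hc0))
      · rw [inner_smul_right] at hx
        exact Or.inr ((hf₂ f).1 ((mul_eq_zero.1 hx).resolve_left hc0))
    classical
    have hsum : ∀ f, g f ω = (if f = f₁ then 1 else 0) + (if f = f₂ then 1 else 0) := by
      intro f
      by_cases h1 : f = f₁
      · have h2 : f ≠ f₂ := h1 ▸ hne12
        rw [if_pos h1, if_neg h2, add_zero]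
        exact hone f p hpL hpK hp0 ((hf₁ f).2 h1)
      by_cases h2 : f = f₂
      · rw [if_neg h1, if_pos h2, zero_add]
        exact hone f q hqL hqK hq0 ((hf₂ f).2 h2)
      rw [if_neg h1, if_neg h2, add_zero]
      have hnm : ω ∉ {ω | X f ω ∈ K} := fun hm =>
        (hray f _ (hXL f) hm (hX0 f) (hXn f)).elim h1 h2
      have hnm' : ω ∉ {ω | -X f ω ∈ K} := fun hm =>
        (hray f _ (neg_mem (hXL f)) hm (neg_ne_zero.2 (hX0 f))
          (by rw [inner_neg_right, hXn f, neg_zero])).elim h1 h2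
      simp only [g, Set.indicator_of_notMem hnm, Set.indicator_of_notMem hnm', add_zero]
    simp only [hsum]
    rw [ENNReal.tsum_add, tsum_ite_eq, tsum_ite_eq, one_add_one_eq_two]

end SphericalTrace

/-! ### The cone over V, its dual, and complementary planes -/

section PolyhedralCones

open SphericalPolyhedra

variable {V : Finset S3}

theorem mem_cone_of_mem {v : S3} (hv : v ∈ V) : (v : EuclideanSpace ℝ (Fin 4)) ∈ cone V := by
  classical
  refine ⟨fun w => if w = v then 1 else 0, fun w _ => by positivity, ?_⟩
  simp [hv]

theorem mem_dualCone_cone_iff {x : EuclideanSpace ℝ (Fin 4)} :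
    x ∈ dualCone (cone V) ↔
      ∀ v ∈ V, inner ℝ x (v : EuclideanSpace ℝ (Fin 4)) ≤ (0 : ℝ) := by
  constructor
  · exact fun h v hv => h v (mem_cone_of_mem hv)
  · rintro h _ ⟨a, ha, rfl⟩
    rw [inner_sum]
    refine Finset.sum_nonpos fun v hv => ?_
    rw [inner_smul_right]
    exact mul_nonpos_of_nonneg_of_nonpos (ha v hv) (h v hv)

theorem inner_sum_smul (x : EuclideanSpace ℝ (Fin 4)) (a : S3 → ℝ) :
    inner ℝ x (∑ v ∈ V, a v • (v : EuclideanSpace ℝ (Fin 4)))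
      = ∑ v ∈ V, a v * inner ℝ x (v : EuclideanSpace ℝ (Fin 4)) := by
  rw [inner_sum]
  simp only [inner_smul_right]

/-- Pairing with x₀ bounds the coefficients of every cone point near x, so near x the cone is
contained in the continuous image of a compact box that itself lies in the cone. -/
theorem isClosed_cone {x₀ : EuclideanSpace ℝ (Fin 4)}
    (h₀ : ∀ v ∈ V, (0 : ℝ) < inner ℝ x₀ (v : EuclideanSpace ℝ (Fin 4))) :
    IsClosed (cone V) := by
  classical
  refine isClosed_of_closure_subset fun x hx => ?_
  let R : ℝ := ‖x₀‖ * (‖x‖ + 1)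
  let A : Set (S3 → ℝ) := Set.univ.pi fun v =>
    Set.Icc 0 |R / inner ℝ x₀ (v : EuclideanSpace ℝ (Fin 4))|
  let T : (S3 → ℝ) → EuclideanSpace ℝ (Fin 4) := fun a =>
    ∑ v ∈ V, a v • (v : EuclideanSpace ℝ (Fin 4))
  have hT : Continuous T := by fun_prop
  have hA : IsCompact (T '' A) := (isCompact_univ_pi fun v => isCompact_Icc).image hT
  have hsub : T '' A ⊆ cone V := by
    rintro _ ⟨a, ha, rfl⟩
    exact ⟨a, fun v _ => (ha v trivial).1, rfl⟩
  apply hsub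
  rw [← hA.isClosed.closure_eq]
  have hx' : x ∈ closure (Metric.ball x 1 ∩ cone V) :=
    Metric.isOpen_ball.inter_closure ⟨Metric.mem_ball_self one_pos, hx⟩
  refine closure_mono ?_ hx'
  rintro _ ⟨hy, a, ha, rfl⟩
  -- The box constrains coefficients at all points of S³, so those off V are reset to 0; the
  -- absolute value in its bounds ensures that 0 is allowed there.
  refine ⟨fun v => if v ∈ V then a v else 0, fun v _ => ?_, ?_⟩
  · by_cases hv : v ∈ V
    · simp only [hv, if_true]
      refine ⟨ha v hv, le_trans ?_ (le_abs_self _)⟩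
      rw [le_div_iff₀ (h₀ v hv)]
      have h1 : a v * inner ℝ x₀ (v : EuclideanSpace ℝ (Fin 4))
          ≤ ∑ v ∈ V, a v * inner ℝ x₀ (v : EuclideanSpace ℝ (Fin 4)) :=
        Finset.single_le_sum (f := fun v : S3 =>
          a v * inner ℝ x₀ (v : EuclideanSpace ℝ (Fin 4)))
          (fun w hw => mul_nonneg (ha w hw) (h₀ w hw).le) hv
      rw [← inner_sum_smul] at h1
      refine h1.trans ((real_inner_le_norm _ _).trans ?_)
      refine mul_le_mul_of_nonneg_left ?_ (norm_nonneg _)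
      rw [mem_ball_iff_norm] at hy
      have := norm_le_norm_add_norm_sub' (∑ v ∈ V, a v • (v : EuclideanSpace ℝ (Fin 4))) x
      linarith
    · simp [hv]
  · exact Finset.sum_congr rfl fun v hv => by simp [hv]

/-- Nonplanarity makes V span ℝ⁴, so the linear combination map is surjective, hence open, and sends
the open positive orthant to an open subset of the cone. -/
theorem interior_cone_nonempty (hV : IsNonPlanar (V : Set S3)) : (interior (cone V)).Nonempty := by
  let T : (V → ℝ) →ₗ[ℝ] EuclideanSpace ℝ (Fin 4) :=
    Fintype.linearCombination ℝ fun v : V => ((v : S3) : EuclideanSpace ℝ (Fin 4))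
  have hTa : ∀ a, T a = ∑ v : V, a v • ((v : S3) : EuclideanSpace ℝ (Fin 4)) := fun a =>
    Fintype.linearCombination_apply _ _ _
  have hsurj : Function.Surjective T := by
    rw [← LinearMap.range_eq_top]
    by_contra hne
    have hbot : (LinearMap.range T)ᗮ ≠ ⊥ := fun h0 =>
      hne ((Submodule.orthogonal_eq_bot_iff).1 h0)
    obtain ⟨ν, hν, hν0⟩ := Submodule.exists_mem_ne_zero_of_ne_bot hbot
    refine hV ⟨toS3 ν hν0, fun v hv => ?_⟩
    have h1 : ((v : S3) : EuclideanSpace ℝ (Fin 4)) ∈ LinearMap.range T := by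
      classical
      refine ⟨Pi.single ⟨v, hv⟩ 1, ?_⟩
      exact (Fintype.linearCombination_apply_single _ _ _ _).trans (one_smul _ _)
    have h2 := (Submodule.mem_orthogonal' _ _).1 hν _ h1
    change inner ℝ (‖ν‖⁻¹ • ν) (v : EuclideanSpace ℝ (Fin 4)) = (0 : ℝ)
    rw [inner_smul_left, h2, mul_zero]
  have hopen : IsOpenMap T := T.isOpenMap_of_finiteDimensional hsurj
  have hO : IsOpen (T '' (Set.univ.pi fun _ => Set.Ioi 0)) :=
    hopen _ (isOpen_set_pi Set.finite_univ fun _ _ => isOpen_Ioi)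
  refine ⟨T fun _ => 1, interior_maximal ?_ hO ⟨fun _ => 1, fun _ _ => Set.mem_Ioi.2 one_pos, rfl⟩⟩
  rintro _ ⟨a, ha, rfl⟩
  classical
  refine ⟨fun v => if hv : v ∈ V then a ⟨v, hv⟩ else 0, fun v hv => ?_, ?_⟩
  · simp only [hv, dif_pos]
    exact (ha ⟨v, hv⟩ trivial).le
  · rw [hTa, ← Finset.sum_coe_sort V]
    exact Finset.sum_congr rfl fun v _ => by simp

theorem solidCone_cone {x₀ : EuclideanSpace ℝ (Fin 4)}
    (h₀ : ∀ v ∈ V, (0 : ℝ) < inner ℝ x₀ (v : EuclideanSpace ℝ (Fin 4)))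
    (hV : IsNonPlanar (V : Set S3)) : SolidCone (cone V) where
  isClosed := isClosed_cone h₀
  add_mem := by
    rintro _ ⟨a, ha, rfl⟩ _ ⟨b, hb, rfl⟩
    refine ⟨fun v => a v + b v, fun v hv => add_nonneg (ha v hv) (hb v hv), ?_⟩
    simp only [add_smul, Finset.sum_add_distrib]
  smul_mem := by
    rintro c hc _ ⟨a, ha, rfl⟩
    refine ⟨fun v => c * a v, fun v hv => mul_nonneg hc (ha v hv), ?_⟩
    simp only [Finset.smul_sum, smul_smul]
  interior_nonempty := interior_cone_nonempty hV
  exists_pos := by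
    refine ⟨x₀, ?_⟩
    rintro _ ⟨a, ha, rfl⟩ hne
    rw [inner_sum_smul]
    have hnn : ∀ v ∈ V, 0 ≤ a v * inner ℝ x₀ (v : EuclideanSpace ℝ (Fin 4)) := fun v hv =>
      mul_nonneg (ha v hv) (h₀ v hv).le
    refine lt_of_le_of_ne (Finset.sum_nonneg hnn) fun h0 => hne ?_
    refine Finset.sum_eq_zero fun v hv => ?_
    have := (Finset.sum_eq_zero_iff_of_nonneg hnn).1 h0.symm v hv
    rw [(mul_eq_zero.1 this).resolve_right (h₀ v hv).ne', zero_smul]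

/-- All summands of the product with ν have the same sign, so an exposed face is the cone over those
generators that are orthogonal to ν. -/
theorem finite_exposedFaces_cone : (exposedFaces (cone V)).Finite := by
  classical
  refine ((V.powerset.finite_toSet).image fun S => cone S).subset ?_
  rintro F ⟨ν, hν, rfl⟩
  refine ⟨V.filter fun v => inner ℝ ν (v : EuclideanSpace ℝ (Fin 4)) = (0 : ℝ),
    Finset.mem_coe.2 (Finset.mem_powerset.2 (Finset.filter_subset _ _)), ?_⟩
  ext x
  constructor
  · rintro ⟨a, ha, rfl⟩
    refine ⟨⟨fun v => if inner ℝ ν (v : EuclideanSpace ℝ (Fin 4)) = (0 : ℝ) then a v else 0,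
      fun v hv => ?_, ?_⟩, ?_⟩
    · dsimp only
      split_ifs with h
      · exact ha v (Finset.mem_filter.2 ⟨hv, h⟩)
      · exact le_rfl
    · rw [Finset.sum_filter]
      exact Finset.sum_congr rfl fun v _ => by simp [ite_smul]
    · rw [inner_sum_smul]
      exact Finset.sum_eq_zero fun v hv => by rw [(Finset.mem_filter.1 hv).2, mul_zero]
  · rintro ⟨⟨a, ha, rfl⟩, h0⟩
    refine ⟨a, fun v hv => ha v (Finset.mem_filter.1 hv).1, ?_⟩
    rw [inner_sum_smul] at h0
    have hnp : ∀ v ∈ V, a v * inner ℝ ν (v : EuclideanSpace ℝ (Fin 4)) ≤ 0 := fun v hv =>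
      mul_nonpos_of_nonneg_of_nonpos (ha v hv) (hν.2 v (mem_cone_of_mem hv))
    have h1 := (Finset.sum_eq_zero_iff_of_nonpos hnp).1 h0
    symm
    refine Finset.sum_subset (Finset.filter_subset _ _) fun v hv hvf => ?_
    have h2 : inner ℝ ν (v : EuclideanSpace ℝ (Fin 4)) ≠ (0 : ℝ) := fun h =>
      hvf (Finset.mem_filter.2 ⟨hv, h⟩)
    rw [(mul_eq_zero.1 (h1 v hv)).resolve_right h2, zero_smul]

/-- The two hypotheses exchange roles: -x₀ is interior to the dual cone, and the negative of an
interior point of the cone is a functional positive on the dual. -/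
theorem solidCone_dualCone {x₀ : EuclideanSpace ℝ (Fin 4)}
    (h₀ : ∀ v ∈ V, (0 : ℝ) < inner ℝ x₀ (v : EuclideanSpace ℝ (Fin 4)))
    (hV : IsNonPlanar (V : Set S3)) : SolidCone (dualCone (cone V)) where
  isClosed := by
    have : dualCone (cone V) = ⋂ y ∈ cone V, {x | inner ℝ x y ≤ (0 : ℝ)} := by
      ext x; simp [dualCone]
    rw [this]
    exact isClosed_biInter fun y _ => isClosed_le (by fun_prop) continuous_const
  add_mem x hx y hy z hz := by
    rw [inner_add_left]
    exact add_nonpos (hx z hz) (hy z hz)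
  smul_mem c hc x hx z hz := by
    rw [inner_smul_left]
    exact mul_nonpos_of_nonneg_of_nonpos hc (hx z hz)
  interior_nonempty := by
    have hO : IsOpen (⋂ v ∈ V, {x : EuclideanSpace ℝ (Fin 4) | inner ℝ x v < (0 : ℝ)}) :=
      isOpen_biInter_finset fun v _ => isOpen_lt (by fun_prop) continuous_const
    refine ⟨-x₀, interior_maximal (fun x hx => ?_) hO ?_⟩
    · rw [mem_dualCone_cone_iff]
      exact fun v hv => (Set.mem_iInter₂.1 hx v hv).le
    · refine Set.mem_iInter₂.2 fun v hv => ?_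
      rw [Set.mem_ofPred_eq, inner_neg_left]
      linarith [h₀ v hv]
  exists_pos := by
    obtain ⟨z, hz⟩ := interior_cone_nonempty hV
    refine ⟨-z, fun y hy hy0 => ?_⟩
    have := SolidCone.inner_neg_of_mem_interior (K := cone V) ⟨hy0, hy⟩ hz
    rw [inner_neg_left, real_inner_comm]
    linarith

/-- The bipolar theorem for closed cones. -/
theorem SolidCone.mem_of_isNormal_dualCone {K : Set (EuclideanSpace ℝ (Fin 4))}
    (hK : SolidCone K) {ν : EuclideanSpace ℝ (Fin 4)} (hν : IsNormal (dualCone K) ν) : ν ∈ K := by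
  by_contra hmem
  obtain ⟨f, u, hf, hu⟩ := geometric_hahn_banach_closed_point hK.convex hK.isClosed hmem
  have hu0 : 0 < u := by simpa using hf 0 hK.zero_mem
  have h1 : (InnerProductSpace.toDual ℝ _).symm f ∈ dualCone K := by
    intro y hy
    rw [InnerProductSpace.toDual_symm_apply]
    by_contra! hpos
    have := hf _ (hK.smul_mem (u / f y) (by positivity) y hy)
    rw [map_smul, smul_eq_mul, div_mul_cancel₀ _ hpos.ne'] at this
    exact lt_irrefl _ this
  have h2 := hν.2 _ h1
  rw [real_inner_comm, InnerProductSpace.toDual_symm_apply] at h2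
  linarith

/-- By the bipolar theorem a normal of the dual is a nonnegative combination of V, and the face it
exposes depends only on which coefficients are nonzero. -/
theorem finite_exposedFaces_dualCone (hK : SolidCone (cone V)) :
    (exposedFaces (dualCone (cone V))).Finite := by
  classical
  refine ((V.powerset.finite_toSet).image fun S : Finset S3 => {y | y ∈ dualCone (cone V) ∧
    ∀ v ∈ S, inner ℝ y (v : EuclideanSpace ℝ (Fin 4)) = (0 : ℝ)}).subset ?_
  rintro F ⟨ν, hν, rfl⟩
  obtain ⟨a, ha, rfl⟩ := hK.mem_of_isNormal_dualCone hν
  refine ⟨V.filter fun v => a v ≠ 0,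
    Finset.mem_coe.2 (Finset.mem_powerset.2 (Finset.filter_subset _ _)), ?_⟩
  ext y
  refine and_congr_right fun hy => ?_
  have hnp : ∀ v ∈ V, a v * inner ℝ y (v : EuclideanSpace ℝ (Fin 4)) ≤ 0 := fun v hv =>
    mul_nonpos_of_nonneg_of_nonpos (ha v hv) (mem_dualCone_cone_iff.1 hy v hv)
  rw [real_inner_comm, inner_sum_smul, Finset.sum_eq_zero_iff_of_nonpos hnp]
  simp only [Finset.mem_filter, and_imp, mul_eq_zero]
  exact forall₂_congr fun v _ => or_iff_not_imp_left.symm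

/-- For complementary orthogonal planes, one meets a cone or the other meets its dual. -/
theorem SolidCone.exists_mem_dualCone_of_disjoint {K : Set (EuclideanSpace ℝ (Fin 4))}
    (hK : SolidCone K) {X : Fin 4 → EuclideanSpace ℝ (Fin 4)} (hX : Orthonormal ℝ X)
    (h : ∀ x ∈ Submodule.span ℝ ({X 0, X 1} : Set (EuclideanSpace ℝ (Fin 4))), x ∈ K → x = 0) :
    ∃ y ∈ Submodule.span ℝ ({X 2, X 3} : Set (EuclideanSpace ℝ (Fin 4))),
      y ∈ dualCone K ∧ y ≠ 0 := by
  set L := Submodule.span ℝ ({X 0, X 1} : Set (EuclideanSpace ℝ (Fin 4)))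
  obtain ⟨ν, hν, hνL⟩ := hK.exists_normal_of_disjoint L.convex ⟨0, L.zero_mem⟩
    (Set.disjoint_left.2 fun x hx hxL => hK.zero_notMem_interior (by
      have := h x hxL (interior_subset hx)
      rwa [this] at hx))
  -- A functional that is nonnegative on a subspace vanishes on it, so ν is orthogonal to L and its
  -- expansion involves only `X 2` and `X 3`.
  have h0 : ∀ x ∈ L, inner ℝ ν x = (0 : ℝ) := fun x hx => by
    have h1 := hνL x hx
    have h2 := hνL (-x) (L.neg_mem hx)
    rw [inner_neg_right] at h2
    linarith
  refine ⟨ν, ?_, hν.2, hν.1⟩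
  let B := (basisOfOrthonormalOfCardEqFinrank hX (by simp)).toOrthonormalBasis (by simpa using hX)
  have hB : ∀ i, B i = X i := fun i => by simp [B]
  have h2 := B.sum_repr' ν
  simp only [hB, Fin.sum_univ_four] at h2
  rw [real_inner_comm, h0 _ (Submodule.subset_span (by simp)), real_inner_comm ν,
    h0 _ (Submodule.subset_span (by simp)), zero_smul, zero_smul, zero_add, zero_add] at h2
  exact Submodule.mem_span_pair.2 ⟨_, _, h2⟩

theorem Orthonormal.inner_span_pair_eq_zero {X : Fin 4 → EuclideanSpace ℝ (Fin 4)}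
    (hX : Orthonormal ℝ X) {x y : EuclideanSpace ℝ (Fin 4)}
    (hx : x ∈ Submodule.span ℝ ({X 0, X 1} : Set (EuclideanSpace ℝ (Fin 4))))
    (hy : y ∈ Submodule.span ℝ ({X 2, X 3} : Set (EuclideanSpace ℝ (Fin 4)))) :
    inner ℝ y x = (0 : ℝ) := by
  obtain ⟨s, t, rfl⟩ := Submodule.mem_span_pair.1 hx
  obtain ⟨u, v, rfl⟩ := Submodule.mem_span_pair.1 hy
  have h : ∀ i j, i ≠ j → inner ℝ (X i) (X j) = (0 : ℝ) := fun i j hij => hX.2 hij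
  simp only [inner_add_left, inner_add_right, inner_smul_left, inner_smul_right]
  rw [h 2 0 (by decide), h 2 1 (by decide), h 3 0 (by decide), h 3 1 (by decide)]
  simp

end PolyhedralCones

/-! ### Combining the two Crofton formulas by duality -/

theorem lemma4p3 (V : Finset SphericalPolyhedra.S3)
    (hhemi : SphericalPolyhedra.IsHemispherical (V : Set SphericalPolyhedra.S3))
    (hnonplanar : SphericalPolyhedra.IsNonPlanar (V : Set SphericalPolyhedra.S3)) :
    SphericalPolyhedra.area (SphericalPolyhedra.polyhedralSphere V)
      + SphericalPolyhedra.area (SphericalPolyhedra.dualPolyhedralSphere V)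
      = ENNReal.ofReal (4 * Real.pi) := by
  obtain ⟨x₀, hx₀⟩ := hhemi
  have h₀ : ∀ v ∈ V, (0 : ℝ) < inner ℝ (x₀ : EuclideanSpace ℝ (Fin 4))
      (v : EuclideanSpace ℝ (Fin 4)) := fun v hv => not_le.1 (hx₀ hv)
  have hC := solidCone_cone h₀ hnonplanar
  have hD := solidCone_dualCone h₀ hnonplanar
  obtain ⟨Ω, _, P, X, hP, hX, hpair⟩ :=
    exists_random_frame (EuclideanSpace ℝ (Fin 4)) (EuclideanSpace.basisFun (Fin 4) ℝ).orthonormal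
  obtain ⟨N, hN, hNarea, hNae⟩ :=
    (hpair 0 1 (by decide)).exists_crofton hC finite_exposedFaces_cone
  obtain ⟨M, hM, hMarea, hMae⟩ :=
    (hpair 2 3 (by decide)).exists_crofton hD (finite_exposedFaces_dualCone hC)
  have hsum : ∀ᵐ ω ∂P, N ω + M ω = 2 := by
    filter_upwards [hNae, hMae] with ω h1 h2
    -- Both planes cutting their cones contradicts orthogonality of z and y; neither cutting
    -- contradicts separation. In the two mixed cases the counts are 2 and 0.
    rcases h1 with ⟨⟨z, hz, hzi⟩, h1⟩ | ⟨hz, h1⟩ <;> rcases h2 with ⟨⟨y, hy, hyi⟩, h2⟩ | ⟨hy, h2⟩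
    · have hy0 : y ≠ 0 := fun h => hD.zero_notMem_interior (h ▸ hyi)
      exact absurd ((hX ω).inner_span_pair_eq_zero hz hy)
        (SolidCone.inner_neg_of_mem_interior ⟨hy0, interior_subset hyi⟩ hzi).ne
    · rw [h1, h2, add_zero]
    · rw [h1, h2, zero_add]
    · obtain ⟨y, hyL, hyD, hy0⟩ := hC.exists_mem_dualCone_of_disjoint (hX ω) hz
      exact absurd (hy y hyL hyD) hy0
  have h2 : ∫⁻ ω, N ω ∂P + ∫⁻ ω, M ω ∂P = 2 := by
    rw [← lintegral_add_left hN, lintegral_congr_ae hsum]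
    simp
  have h3 : 2 * (SphericalPolyhedra.area (SphericalPolyhedra.polyhedralSphere V)
      + SphericalPolyhedra.area (SphericalPolyhedra.dualPolyhedralSphere V))
      = 2 * ENNReal.ofReal (4 * Real.pi) := by
    refine (mul_add _ _ _).trans ((congrArg₂ (· + ·) hNarea hMarea).trans ?_)
    rw [← mul_add, h2, mul_comm]
  exact (ENNReal.mul_right_inj two_ne_zero ENNReal.ofNat_ne_top).1 h3
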